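/- Let $K$ be a field, $S=K[x_1,\dots,x_n]$, and let $I\subset S$ be a strongly stable ideal, i.e. a monomial ideal such that whenever $m$ is a minimal monomial generator of $I$, $x_i\mid m$ and $j<i$, then $(x_j/x_i)\,m\in I$. For a tuple $\mathbf a=(a_1,\dots,a_t)$ of positive integers with $1\le t\le n$, put $\mathfrak m^{\mathbf a}:=(x_1^{a_1},\dots,x_t^{a_t})$, $t(\mathbf a):=t$ and $e(\mathbf a):=a_t$. Let $$I=\bigcap_{\mathbf a\in E}\mathfrak m^{\mathbf a}$$ be the irredundant irreducible decomposition of $I$, where $E$ is a finite set of such tuples. For a homogeneous ideal $J\subset S$, let $\deg(S/J)$ denote the degree (multiplicity) of $S/J$, i.e. $d!$ times the leading coefficient of the polynomial in $k$, of degree $d$, that agrees with $\sum_{j\le k}\dim_K (S/J)_j$ for all large $k$ (and $0$ if $J=S$). The arithmetic degree of $S/I$ and its $i$-th part are $$\operatorname{adeg}(S/I)=\sum_{\mathfrak p\in\operatorname{Ass}(S/I)}\operatorname{mult}_{S/I}(\mathfrak p)\,\deg(S/\mathfrak p),\qquad \operatorname{adeg}_i(S/I)=\sum_{\substack{\mathfrak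 p\in\operatorname{Ass}(S/I)\\ \dim S/\mathfrak p=i}}\operatorname{mult}_{S/I}(\mathfrak p)\,\deg(S/\mathfrak p),$$ where $\operatorname{mult}_{S/I}(\mathfrak p)$ is the length of the $S_{\mathfrak p}$-module $H^0_{\mathfrak pS_{\mathfrak p}}\bigl((S/I)_{\mathfrak p}\bigr)$. Then for every $i\ge 0$ $$\operatorname{adeg}_i(S/I)=\sum_{\substack{\mathbf a\in E\\ t(\mathbf a)=n-i}}e(\mathbf a).$$ Consequently $$\operatorname{adeg}(S/I)=\sum_{\mathbf a\in E}e(\mathbf a)\qquad\text{and}\qquad \deg(S/I)=\sum_{\substack{\mathbf a\in E\\ t(\mathbf a)=\operatorname{ht}(I)}}e(\mathbf a).$$ -/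

import Mathlib

namespace StronglyStable

open MvPolynomial

section Ideals

variable {K : Type*} [Field K] {n : ℕ}

/-- An ideal of `K[x₁, …, xₙ]` generated by monomials. -/
def IsMonomialIdeal (I : Ideal (MvPolynomial (Fin n) K)) : Prop :=
  ∃ s : Set (Fin n →₀ ℕ), I = Ideal.span ((fun u => monomial u (1 : K)) '' s)

/-- The exponents of the minimal monomial generators of a monomial ideal, that is, of the monomials
in `I` that are minimal with respect to divisibility. -/
def minGens (I : Ideal (MvPolynomial (Fin n) K)) : Set (Fin n →₀ ℕ) :=
  {u | Minimal (fun v => monomial v (1 : K) ∈ I) u}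

/-- `I` is a monomial ideal, and whenever `x^u` is a minimal monomial generator divisible by `xᵢ`
and `j < i`, the monomial `(xⱼ / xᵢ) x^u` lies in `I`. -/
def IsStronglyStable (I : Ideal (MvPolynomial (Fin n) K)) : Prop :=
  IsMonomialIdeal I ∧
    ∀ u ∈ minGens I, ∀ i j : Fin n, 0 < u i → j < i →
      monomial (u - Finsupp.single i 1 + Finsupp.single j 1) (1 : K) ∈ I

end Ideals

/-- The set `ℤ_{>0} ∪ (ℤ_{>0})² ∪ ⋯ ∪ (ℤ_{>0})ⁿ` of tuples of positive integers of length between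
`1` and `n`; the first component of the dependent pair is the length minus one. -/
abbrev ExpTuple (n : ℕ) : Type := Σ s : Fin n, (Fin (s.1 + 1) → ℕ+)

/-- The length `t(a)` of `a = (a₁, …, a_t)`. -/
def ExpTuple.t {n : ℕ} (a : ExpTuple n) : ℕ := a.1.1 + 1

/-- The last entry `e(a) = a_t` of `a = (a₁, …, a_t)`. -/
def ExpTuple.e {n : ℕ} (a : ExpTuple n) : ℕ := a.2 (Fin.last a.1.1)

/-- The irreducible ideal `𝔪^a = (x₁^{a₁}, …, x_t^{a_t})` of `K[x₁, …, xₙ]`. -/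
noncomputable def irredIdeal (K : Type*) [Field K] {n : ℕ} (a : ExpTuple n) :
    Ideal (MvPolynomial (Fin n) K) :=
  Ideal.span (Set.range fun j : Fin (a.1.1 + 1) =>
    (X (Fin.castLE a.1.isLt j) : MvPolynomial (Fin n) K) ^ (a.2 j : ℕ))

/-- `I = ⋂_{a ∈ E} 𝔪^a`, and no proper subfamily of `E` has intersection `I`. -/
def IsIrredundantDecomposition {K : Type*} [Field K] {n : ℕ}
    (I : Ideal (MvPolynomial (Fin n) K)) (E : Finset (ExpTuple n)) : Prop :=
  (I = ⨅ a ∈ E, irredIdeal K a) ∧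
    ∀ F : Finset (ExpTuple n), F ⊂ E → I ≠ ⨅ a ∈ F, irredIdeal K a

section Degree

variable {K : Type*} [Field K] {n : ℕ}

/-- The Hilbert function `k ↦ dim_K (S/I)_k` of `S/I`, for a homogeneous ideal `I` of
`S = K[x₁, …, xₙ]`; the component `(S/I)_k` is the image of `S_k` in `S/I`. -/
noncomputable def hilbertFunction (I : Ideal (MvPolynomial (Fin n) K)) (k : ℕ) : ℕ :=
  Module.finrank K
    ((homogeneousSubmodule (Fin n) K k).map (Ideal.Quotient.mkₐ K I).toLinearMap)

/-- `P` is the Hilbert–Samuel polynomial of `S/I`, that is, `P(k) = ∑_{j ≤ k} dim_K (S/I)_j` for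
all large `k`. There is at most one such `P`, and for homogeneous `I` there is one, of degree
`dim S/I` if `I ≠ S`. -/
def IsHilbertSamuelPoly (I : Ideal (MvPolynomial (Fin n) K)) (P : Polynomial ℚ) : Prop :=
  ∀ᶠ k : ℕ in Filter.atTop,
    ((∑ j ∈ Finset.range (k + 1), hilbertFunction I j : ℕ) : ℚ) = P.eval (k : ℚ)

open Classical in
/-- The degree (multiplicity) `deg(S/I)` for a homogeneous ideal `I`: the number `e` such that
`∑_{j ≤ k} dim_K (S/I)_j = (e / d!) k^d + (lower order terms)` for large `k`, where `d` is the
degree of this polynomial. -/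
noncomputable def degree (I : Ideal (MvPolynomial (Fin n) K)) : ℚ :=
  if h : ∃ P, IsHilbertSamuelPoly I P then
    (Nat.factorial h.choose.natDegree : ℚ) * h.choose.leadingCoeff
  else 0

end Degree

section ArithmeticDegree

/-- The submodule `H⁰_J(M) = {m ∈ M | J^k m = 0 for some k}`. -/
def zerothLocalCohomology {R : Type*} [CommRing R] (J : Ideal R) (M : Type*) [AddCommGroup M]
    [Module R M] : Submodule R M :=
  ⨆ k : ℕ, Submodule.torsionBySet R M ((J ^ k : Ideal R) : Set R)

/-- The length multiplicity of a prime `p` of `R` with respect to `M`: the length of the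
`R_p`-module `H⁰_{p R_p}(M_p)`. It is finite if `R` is Noetherian and `M` is finitely generated. -/
noncomputable def lengthMult {R : Type*} [CommRing R] (p : Ideal R) [p.IsPrime] (M : Type*)
    [AddCommGroup M] [Module R M] : ℕ∞ :=
  Module.length (Localization.AtPrime p)
    (zerothLocalCohomology (IsLocalRing.maximalIdeal (Localization.AtPrime p))
      (LocalizedModule p.primeCompl M))

variable {K : Type*} [Field K] {n : ℕ}

/-- The contribution `mult_{S/I}(p) · deg(S/p)` of a prime `p` to the arithmetic degree of `S/I`. -/
noncomputable def adegTerm (I : Ideal (MvPolynomial (Fin n) K))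
    (p : PrimeSpectrum (MvPolynomial (Fin n) K)) : ℚ :=
  ((lengthMult p.asIdeal (MvPolynomial (Fin n) K ⧸ I)).toNat : ℚ) * degree p.asIdeal

/-- The arithmetic degree of `S/I`: the sum of `mult_{S/I}(p) · deg(S/p)` over the (finitely many)
associated primes `p` of `S/I`. -/
noncomputable def adeg (I : Ideal (MvPolynomial (Fin n) K)) : ℚ :=
  ∑ᶠ (p : PrimeSpectrum (MvPolynomial (Fin n) K))
    (_ : p.asIdeal ∈ associatedPrimes (MvPolynomial (Fin n) K) (MvPolynomial (Fin n) K ⧸ I)),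
    adegTerm I p

/-- The `i`-th arithmetic degree of `S/I`: the same sum, over the associated primes `p` with
`dim S/p = i` only. -/
noncomputable def adegAt (I : Ideal (MvPolynomial (Fin n) K)) (i : ℕ) : ℚ :=
  ∑ᶠ (p : PrimeSpectrum (MvPolynomial (Fin n) K))
    (_ : p.asIdeal ∈ associatedPrimes (MvPolynomial (Fin n) K) (MvPolynomial (Fin n) K ⧸ I) ∧
      ringKrullDim (MvPolynomial (Fin n) K ⧸ p.asIdeal) = (i : WithBot ℕ∞)),
    adegTerm I p

end ArithmeticDegree

end StronglyStable

/-! A monomial lies outside `I` exactly when its exponent lies in the `box` of some `a ∈ E`. The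
core of the proof is a Stanley decomposition of this union of boxes: it is the disjoint union of the
cones `x^(a.corner k) · K[x_{t+1}, …, x_n]` over `a ∈ E`, `0 ≤ k < e(a)`, where `t = t(a)`.
Irredundancy makes the cones disjoint (`eq_of_mem_cone_corner`) and strong stability makes them
cover (`exists_mem_cone_corner`). So each tuple contributes `e(a)` cones of dimension `n - t(a)`.

For the degree, only cones of largest dimension affect the leading term of the Hilbert–Samuel
polynomial (`degree_eq_card_of_stanley`), and their tuples have length `ht I`.

For the arithmetic degree, write `P_t = (x₁, …, x_t)`. Each `𝔪^a` is `P_{t(a)}`-primary, so the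
associated primes are the `P_{t(a)}` (`isAssociatedPrime_iff`), each with `deg(S/P_t) = 1`. After
localizing at `P_t`, the module `H⁰` is generated by the corners of the tuples of length `t`;
ordered by degree they yield a composition series, so its length is the sum of the `e(a)` with `t(a)
= t` (`lengthMult_varIdeal`).

Indices start at `0`: `a.1 = t(a) - 1` is the index of the last variable involved in `𝔪^a`. -/

namespace StronglyStable

open MvPolynomial

/-! ### Boxes, corners and the disjoint covering by cones -/

section Combinatorics

variable {n : ℕ}

/-- The `j`-th entry of the tuple `a`, for an index `j` in `Fin n`; zero beyond the length. -/
def ExpTuple.entry (a : ExpTuple n) (j : Fin n) : ℕ :=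
  if h : j.1 < a.1.1 + 1 then a.2 ⟨j.1, h⟩ else 0

/-- The exponents of the monomials outside `𝔪^a`. -/
def ExpTuple.box (a : ExpTuple n) : Set (Fin n →₀ ℕ) :=
  {u | ∀ j ≤ a.1, u j < a.entry j}

/-- The exponent `(a₁ - 1, …, a_{t-1} - 1, k, 0, …, 0)`. -/
noncomputable def ExpTuple.corner (a : ExpTuple n) (k : ℕ) : Fin n →₀ ℕ :=
  Finsupp.equivFunOnFinite.symm fun j =>
    if j < a.1 then a.entry j - 1 else if j = a.1 then k else 0

/-- The exponents that agree with `c` in all positions up to `s`. -/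
def cone (s : Fin n) (c : Fin n →₀ ℕ) : Set (Fin n →₀ ℕ) :=
  {u | ∀ j ≤ s, u j = c j}

namespace ExpTuple

lemma e_eq_entry (a : ExpTuple n) : a.e = a.entry a.1 := by
  simp [e, entry, Fin.last]

lemma entry_pos (a : ExpTuple n) {j : Fin n} (hj : j ≤ a.1) : 0 < a.entry j := by
  have : j.1 < a.1.1 + 1 := Nat.lt_succ_of_le hj
  simp [entry, this]

lemma e_pos (a : ExpTuple n) : 0 < a.e := by
  rw [e_eq_entry]; exact a.entry_pos le_rfl

lemma entry_castLE (a : ExpTuple n) (j : Fin (a.1.1 + 1)) :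
    a.entry (Fin.castLE a.1.isLt j) = a.2 j := by
  simp [entry, Nat.not_lt.2 (Nat.le_of_lt_succ j.2)]

lemma corner_of_lt (a : ExpTuple n) (k : ℕ) {j : Fin n} (hj : j < a.1) :
    a.corner k j = a.entry j - 1 := by simp [corner, hj]

lemma corner_self (a : ExpTuple n) (k : ℕ) : a.corner k a.1 = k := by simp [corner]

lemma corner_of_gt (a : ExpTuple n) (k : ℕ) {j : Fin n} (hj : a.1 < j) : a.corner k j = 0 := by
  simp [corner, hj.not_gt, hj.ne']

lemma cone_corner_subset_box (a : ExpTuple n) {k : ℕ} (hk : k < a.e) :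
    cone a.1 (a.corner k) ⊆ a.box := by
  intro u hu j hj
  rw [hu j hj]
  rcases hj.lt_or_eq with h | rfl
  · rw [corner_of_lt a k h]; have := a.entry_pos hj; omega
  · rw [corner_self, ← e_eq_entry]; exact hk

lemma box_subset_box {a b : ExpTuple n} (h : b.1 ≤ a.1) (h' : ∀ j ≤ b.1, a.entry j ≤ b.entry j) :
    a.box ⊆ b.box :=
  fun _ hu j hj => (hu j (hj.trans h)).trans_le (h' j hj)

/-- The corner cones of an irredundant family of boxes are pairwise disjoint. -/
lemma eq_of_mem_cone_corner {E : Finset (ExpTuple n)}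
    (hirr : ∀ a ∈ E, ∀ b ∈ E, a.box ⊆ b.box → a = b) {a b : ExpTuple n} (ha : a ∈ E) (hb : b ∈ E)
    {k l : ℕ} (hk : k < a.e) (hl : l < b.e) {u : Fin n →₀ ℕ}
    (hu : u ∈ cone a.1 (a.corner k)) (hv : u ∈ cone b.1 (b.corner l)) : a = b ∧ k = l := by
  wlog hab : b.1 ≤ a.1 generalizing a b k l
  · exact (this hb ha hl hk hv hu (le_of_not_ge hab)).imp Eq.symm Eq.symm
  have hub := cone_corner_subset_box b hl hv
  -- If `b` is shorter, the entries `a_j - 1` of `u` lie below those of `b`, so one box contains the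
  -- other. If the lengths agree, all entries but the last agree and comparing the last ones again
  -- nests the boxes.
  have key : a = b := by
    rcases hab.lt_or_eq with h | h
    · refine hirr a ha b hb (box_subset_box hab fun j hj => ?_)
      have h1 := hub j hj
      rw [hu j (hj.trans hab), corner_of_lt a k (hj.trans_lt h)] at h1
      omega
    · have hlt : ∀ j < a.1, a.entry j = b.entry j := fun j hj => by
        have h1 := hu j hj.le
        have h2 := hv j (h ▸ hj.le)
        rw [corner_of_lt a k hj] at h1
        rw [corner_of_lt b l (h ▸ hj)] at h2
        have := a.entry_pos hj.le
        have := b.entry_pos (h ▸ hj.le)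
        omega
      rcases le_total (a.entry a.1) (b.entry a.1) with h' | h'
      · refine hirr a ha b hb (box_subset_box hab fun j hj => ?_)
        rcases (h ▸ hj : j ≤ a.1).lt_or_eq with hj | rfl
        exacts [(hlt j hj).le, h']
      · refine (hirr b hb a ha (box_subset_box h.ge fun j hj => ?_)).symm
        rcases hj.lt_or_eq with hj | rfl
        exacts [(hlt j hj).ge, h']
  subst key
  refine ⟨rfl, ?_⟩
  have h1 := hu a.1 le_rfl
  have h2 := hv a.1 le_rfl
  rw [corner_self] at h1 h2
  omega

/-- If the union of the boxes is closed under moving exponents to later variables, then it is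
covered by the corner cones. -/
lemma exists_mem_cone_corner {E : Finset (ExpTuple n)}
    (hst : ∀ u : Fin n →₀ ℕ, (∃ a ∈ E, u ∈ a.box) → ∀ i j : Fin n, j < i → 0 < u j →
      ∃ a ∈ E, u - Finsupp.single j 1 + Finsupp.single i 1 ∈ a.box)
    {a : ExpTuple n} (ha : a ∈ E) {u : Fin n →₀ ℕ} (hu : u ∈ a.box) :
    ∃ b ∈ E, b.1 ≤ a.1 ∧ ∃ k < b.e, u ∈ cone b.1 (b.corner k) := by
  classical
  -- Among the boxes containing `u`, take one of least length and, for that length, of greatest last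
  -- entry; `u` then lies in one of its corner cones.
  obtain ⟨b₀, hb₀, hmin⟩ := (E.filter fun b => u ∈ b.box).exists_min_image (fun b => b.1)
    ⟨a, by simp [ha, hu]⟩
  obtain ⟨b, hb, hmax⟩ := ((E.filter fun b => u ∈ b.box).filter fun b => b.1 = b₀.1).exists_max_image
    (fun b => b.e) ⟨b₀, by simpa using hb₀⟩
  simp only [Finset.mem_filter, and_imp] at hb₀ hb hmin hmax
  obtain ⟨⟨hbE, hub⟩, hbb⟩ := hb
  refine ⟨b, hbE, hbb ▸ hmin a ha hu, u b.1, e_eq_entry b ▸ hub b.1 le_rfl, fun j hj => ?_⟩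
  rcases hj.lt_or_eq with hj | rfl
  swap
  · rw [corner_self]
  rw [corner_of_lt b _ hj]
  by_contra hne
  have hlt : u j + 1 < b.entry j := by have := hub j hj.le; omega
  obtain ⟨N, hN⟩ : ∃ N, ∀ c ∈ E, ∀ i, c.entry i ≤ N := by
    refine ⟨E.sup fun c => Finset.univ.sup c.entry, fun c hc i => ?_⟩
    exact (Finset.le_sup (f := c.entry) (Finset.mem_univ i)).trans
      (Finset.le_sup (f := fun c => Finset.univ.sup c.entry) hc)
  -- If `u j` is not maximal, raise it by one, put the last coordinate of the box at its maximum and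
  -- fill later coordinates with `N`. Moving one unit from `j` to `b.1` restores `u j` and pushes
  -- the last coordinate to `b.e`, just outside `b.box`; the new box `c` cannot be longer than `b`,
  -- since no entry exceeds `N`.
  let w : Fin n →₀ ℕ := Finsupp.equivFunOnFinite.symm fun i =>
    if i < b.1 then (if i = j then u j + 1 else u i) else if i = b.1 then b.e - 1 else N
  have hw : w ∈ b.box := by
    intro i hi
    rcases hi.lt_or_eq with hi | rfl
    · by_cases hij : i = j
      · subst hij; simpa [w, hi] using hlt
      · simpa [w, hi, hij] using hub i hi.le
    · have := b.e_pos
      simp only [w, Finsupp.equivFunOnFinite_symm_apply_apply, lt_irrefl, if_true, if_false]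
      rw [← e_eq_entry]; omega
  obtain ⟨c, hc, hwc⟩ := hst w ⟨b, hbE, hw⟩ b.1 j hj (by simp [w, hj])
  have hcb : c.1 ≤ b.1 := by
    by_contra h
    have h1 := hwc c.1 le_rfl
    have h2 : (w - Finsupp.single j 1 + Finsupp.single b.1 1 : Fin n →₀ ℕ) c.1 = N := by
      have hbc := lt_of_not_ge h
      simp [w, hbc.not_gt, hbc.ne', (hj.trans hbc).ne']
    rw [h2] at h1
    exact (hN c hc c.1).not_gt h1
  have hlow : ∀ i ≤ c.1, i < b.1 → u i < c.entry i := fun i hi hib => by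
    have h1 := hwc i hi
    by_cases hij : i = j
    · subst hij; simpa [w, hib, hib.ne, hib.ne'] using h1
    · simpa [w, hib, hib.ne, hib.ne', hij, Finsupp.single_apply, Ne.symm hij] using h1
  -- A shorter `c` contradicts the minimal length; one of equal length has a larger last entry and
  -- still contains `u`, against the choice of `b`.
  rcases hcb.lt_or_eq with h | h
  · have := hmin c hc fun i hi => hlow i hi (hi.trans_lt h)
    rw [← hbb] at this
    exact this.not_gt h
  · have h1 := hwc c.1 le_rfl
    have h2 : (w - Finsupp.single j 1 + Finsupp.single b.1 1 : Fin n →₀ ℕ) c.1 = b.e := by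
      have := b.e_pos
      rw [h]
      simp [w, hj.ne]
      omega
    rw [h2, ← e_eq_entry] at h1
    have huc : u ∈ c.box := fun i hi => by
      rcases hi.lt_or_eq with hi' | rfl
      · exact hlow i hi (h ▸ hi')
      · have h3 := hub b.1 le_rfl
        rw [← e_eq_entry, ← h] at h3
        rw [← e_eq_entry]
        exact h3.trans h1
    exact (hmax c hc huc (h.trans hbb)).not_gt h1

end ExpTuple

end Combinatorics

/-! ### Membership in the ideals read off from supports -/

section Support

variable {K : Type*} [Field K] {n : ℕ}

lemma mem_irredIdeal_iff {a : ExpTuple n} {f : MvPolynomial (Fin n) K} :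
    f ∈ irredIdeal K a ↔ ∀ u ∈ f.support, u ∉ a.box := by
  have : irredIdeal K a = Ideal.span ((fun u => monomial u (1 : K)) ''
      (Set.range fun j : Fin (a.1.1 + 1) => Finsupp.single (Fin.castLE a.1.isLt j) (a.2 j : ℕ))) := by
    rw [irredIdeal, ← Set.range_comp]
    simp [Function.comp_def, X_pow_eq_monomial]
  rw [this, mem_ideal_span_monomial_image]
  refine forall₂_congr fun u _ => ?_
  simp only [Set.mem_range, exists_exists_eq_and, Finsupp.single_le_iff, ExpTuple.box,
    Set.mem_ofPred_eq, not_forall, not_lt]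
  constructor
  · rintro ⟨j, hj⟩
    exact ⟨Fin.castLE a.1.isLt j, Nat.le_of_lt_succ j.2, by rwa [a.entry_castLE]⟩
  · rintro ⟨j, hj, h⟩
    refine ⟨⟨j.1, Nat.lt_succ_of_le hj⟩, ?_⟩
    rw [← a.entry_castLE]; exact h

lemma monomial_mem_irredIdeal_iff {a : ExpTuple n} {u : Fin n →₀ ℕ} :
    monomial u (1 : K) ∈ irredIdeal K a ↔ u ∉ a.box := by
  classical simp [mem_irredIdeal_iff, support_monomial]

lemma mem_iInf_irredIdeal_iff {E : Finset (ExpTuple n)} {f : MvPolynomial (Fin n) K} :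
    f ∈ ⨅ a ∈ E, irredIdeal K a ↔ ∀ u ∈ f.support, ∀ a ∈ E, u ∉ a.box := by
  simp only [Ideal.mem_iInf, mem_irredIdeal_iff]
  exact ⟨fun h u hu a ha => h a ha u hu, fun h a ha u hu => h u hu a ha⟩

lemma IsIrredundantDecomposition.mem_iff {I : Ideal (MvPolynomial (Fin n) K)}
    {E : Finset (ExpTuple n)} (hE : IsIrredundantDecomposition I E)
    {f : MvPolynomial (Fin n) K} :
    f ∈ I ↔ ∀ u ∈ f.support, ∀ a ∈ E, u ∉ a.box := by
  rw [hE.1, mem_iInf_irredIdeal_iff]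

lemma IsIrredundantDecomposition.monomial_mem_iff {I : Ideal (MvPolynomial (Fin n) K)}
    {E : Finset (ExpTuple n)} (hE : IsIrredundantDecomposition I E) {u : Fin n →₀ ℕ} :
    monomial u (1 : K) ∈ I ↔ ∀ a ∈ E, u ∉ a.box := by
  classical simp [hE.mem_iff, support_monomial]

lemma IsIrredundantDecomposition.not_iInf_erase_le {I : Ideal (MvPolynomial (Fin n) K)}
    {E : Finset (ExpTuple n)} (hE : IsIrredundantDecomposition I E) [DecidableEq (ExpTuple n)]
    {a : ExpTuple n} (ha : a ∈ E) : ¬ (⨅ b ∈ E.erase a, irredIdeal K b) ≤ irredIdeal K a := by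
  intro h
  refine hE.2 _ (Finset.erase_ssubset ha) ?_
  rw [hE.1]
  conv_lhs => rw [← Finset.insert_erase ha, Finset.iInf_insert]
  exact inf_eq_right.2 h

lemma IsIrredundantDecomposition.eq_of_box_subset_box {I : Ideal (MvPolynomial (Fin n) K)}
    {E : Finset (ExpTuple n)} (hE : IsIrredundantDecomposition I E) :
    ∀ a ∈ E, ∀ b ∈ E, a.box ⊆ b.box → a = b := by
  classical
  intro a ha b hb h
  by_contra hab
  refine hE.not_iInf_erase_le ha ((iInf₂_le b (Finset.mem_erase.2 ⟨Ne.symm hab, hb⟩)).trans ?_)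
  intro f hf
  rw [mem_irredIdeal_iff] at hf ⊢
  exact fun u hu hua => hf u hu (h hua)

lemma monomial_mem_of_le {I : Ideal (MvPolynomial (Fin n) K)} {u v : Fin n →₀ ℕ}
    (hu : monomial u (1 : K) ∈ I) (h : u ≤ v) : monomial v (1 : K) ∈ I :=
  I.mem_of_dvd (monomial_dvd_monomial.2 ⟨Or.inr h, one_dvd _⟩) hu

/-- The exchange property of a strongly stable ideal holds for all its monomials. -/
lemma IsStronglyStable.monomial_mem {I : Ideal (MvPolynomial (Fin n) K)} (hI : IsStronglyStable I)
    {w : Fin n →₀ ℕ} (hw : monomial w (1 : K) ∈ I) {i j : Fin n} (hwi : 0 < w i) (hji : j < i) :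
    monomial (w - Finsupp.single i 1 + Finsupp.single j 1) (1 : K) ∈ I := by
  -- Take a minimal generator `x^u` dividing `x^w`. If `u i < w i` it still divides the moved
  -- monomial; otherwise `u i = w i > 0` and the exchange applies to `u` itself.
  obtain ⟨u, huw, hu⟩ := exists_minimal_le_of_wellFoundedLT
    (fun v => monomial v (1 : K) ∈ I) w hw
  rcases (huw i).lt_or_eq with h | h
  · refine monomial_mem_of_le hu.prop fun k => ?_
    have := huw k
    by_cases hk : k = i
    · subst hk; simp; omega
    · simp [Finsupp.single_apply, Ne.symm hk]; omega
  · refine monomial_mem_of_le (hI.2 u hu i j (h ▸ hwi) hji) fun k => ?_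
    have := huw k
    simp only [Finsupp.add_apply, Finsupp.tsub_apply]
    omega

/-- The exchange property in complementary form: were the moved monomial in `I`, moving the unit
back would put `x^u` in `I`. -/
lemma IsStronglyStable.exists_mem_box {I : Ideal (MvPolynomial (Fin n) K)}
    (hI : IsStronglyStable I) {E : Finset (ExpTuple n)} (hE : IsIrredundantDecomposition I E)
    (u : Fin n →₀ ℕ) (hu : ∃ a ∈ E, u ∈ a.box) (i j : Fin n) (hji : j < i) (huj : 0 < u j) :
    ∃ a ∈ E, u - Finsupp.single j 1 + Finsupp.single i 1 ∈ a.box := by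
  by_contra! h
  have h1 := hI.monomial_mem (hE.monomial_mem_iff.2 h) (i := i) (j := j) (by simp) hji
  have h2 : u - Finsupp.single j 1 + Finsupp.single i 1 - Finsupp.single i 1 +
      Finsupp.single j 1 = u := by
    rw [add_tsub_cancel_right, tsub_add_cancel_of_le]
    simpa [Finsupp.single_le_iff, Nat.one_le_iff_ne_zero] using huj.ne'
  rw [h2, hE.monomial_mem_iff] at h1
  obtain ⟨a, ha, hua⟩ := hu
  exact h1 a ha hua

end Support

/-! ### The primes generated by initial segments of the variables -/

section VarIdeal

variable (K : Type*) [Field K] (n : ℕ)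

/-- The ideal `(x₁, …, x_t)` of `K[x₁, …, xₙ]`. -/
noncomputable def varIdeal (t : ℕ) : Ideal (MvPolynomial (Fin n) K) :=
  Ideal.span (X '' {j : Fin n | j.1 < t})

/-- The map `K[x₁, …, xₙ] → K[x_{t+1}, …, xₙ]` that kills `x₁, …, x_t`. -/
noncomputable def killVars (t : ℕ) :
    MvPolynomial (Fin n) K →ₐ[K] MvPolynomial {j : Fin n // t ≤ j.1} K :=
  killCompl (Subtype.val_injective (p := fun j : Fin n => t ≤ j.1))

variable {K n}

lemma mem_varIdeal_iff {t : ℕ} {f : MvPolynomial (Fin n) K} :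
    f ∈ varIdeal K n t ↔ ∀ u ∈ f.support, ∃ j : Fin n, j.1 < t ∧ u j ≠ 0 :=
  mem_ideal_span_X_image

lemma X_mem_varIdeal_iff {t : ℕ} {j : Fin n} :
    (X j : MvPolynomial (Fin n) K) ∈ varIdeal K n t ↔ j.1 < t := by
  classical
  simp [mem_varIdeal_iff, support_X, Finsupp.single_apply]

lemma killVars_surjective (t : ℕ) : Function.Surjective (killVars K n t) := fun p =>
  ⟨_, killCompl_rename_app _ p⟩

/-- Two algebra maps into the quotient agree on variables. This identifies the kernel of `killVars`,
and lets a polynomial be replaced modulo `(x₁, …, x_t)` by one in the later variables. -/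
lemma sub_rename_killVars_mem (t : ℕ) (f : MvPolynomial (Fin n) K) :
    f - rename Subtype.val (killVars K n t f) ∈ varIdeal K n t := by
  rw [← Ideal.Quotient.mk_eq_mk_iff_sub_mem]
  have : Ideal.Quotient.mkₐ K (varIdeal K n t) =
      (Ideal.Quotient.mkₐ K (varIdeal K n t)).comp ((rename Subtype.val).comp (killVars K n t)) := by
    ext j
    by_cases hj : t ≤ j.1
    · have hX : (X j : MvPolynomial (Fin n) K) =
          rename Subtype.val (X (⟨j, hj⟩ : {j : Fin n // t ≤ j.1})) := by rw [rename_X]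
      rw [AlgHom.comp_apply, AlgHom.comp_apply, hX, killVars, killCompl_rename_app]
    · simp [killVars, killCompl, hj, Ideal.Quotient.eq_zero_iff_mem, X_mem_varIdeal_iff]
      omega
  exact DFunLike.congr_fun this f

lemma ker_killVars (t : ℕ) : RingHom.ker (killVars K n t) = varIdeal K n t := by
  refine le_antisymm (fun f hf => ?_) (Ideal.span_le.2 ?_)
  · have := sub_rename_killVars_mem t f
    rwa [(RingHom.mem_ker).1 hf, map_zero, sub_zero] at this
  · rintro _ ⟨j, hj, rfl⟩
    have : ¬ t ≤ j.1 := not_le.2 hj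
    simp [killVars, killCompl, this]

instance varIdeal_isPrime (t : ℕ) : (varIdeal K n t).IsPrime :=
  ker_killVars (K := K) (n := n) t ▸ RingHom.ker_isPrime _

lemma varIdeal_mono {s t : ℕ} (h : s ≤ t) : varIdeal K n s ≤ varIdeal K n t :=
  Ideal.span_mono (Set.image_mono fun _ hj => lt_of_lt_of_le hj h)

lemma varIdeal_lt_varIdeal {s t : ℕ} (h : s < t) (ht : t ≤ n) :
    varIdeal K n s < varIdeal K n t := by
  refine (varIdeal_mono h.le).lt_of_not_ge fun h' => ?_
  exact lt_irrefl s (X_mem_varIdeal_iff.1 (h' ((X_mem_varIdeal_iff (j := ⟨s, h.trans_le ht⟩)).2 h)))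

lemma varIdeal_injOn {s t : ℕ} (hs : s ≤ n) (ht : t ≤ n) (h : varIdeal K n s = varIdeal K n t) :
    s = t := by
  rcases lt_trichotomy s t with h' | h' | h'
  · exact absurd h (varIdeal_lt_varIdeal h' ht).ne
  · exact h'
  · exact absurd h (varIdeal_lt_varIdeal h' hs).ne'

lemma ringKrullDim_quotient_varIdeal {t : ℕ} (ht : t ≤ n) :
    ringKrullDim (MvPolynomial (Fin n) K ⧸ varIdeal K n t) = ((n - t : ℕ) : WithBot ℕ∞) := by
  have e := (Ideal.quotEquivOfEq (ker_killVars (K := K) (n := n) t).symm).trans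
    (RingHom.quotientKerEquivOfSurjective (f := (killVars K n t).toRingHom) (killVars_surjective t))
  rw [ringKrullDim_eq_of_ringEquiv e, MvPolynomial.ringKrullDim_of_isNoetherianRing,
    ringKrullDim_eq_zero_of_field, zero_add, Nat.card_eq_fintype_card, Fintype.card_subtype]
  have h1 := Finset.card_filter_add_card_filter_not (s := (Finset.univ : Finset (Fin n)))
    (fun j : Fin n => j.1 < t)
  simp only [not_lt, Finset.card_univ, Fintype.card_fin, Fin.card_filter_val_lt, min_eq_right ht]
    at h1
  rw [← h1, Nat.add_sub_cancel_left]
  congr!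

lemma height_varIdeal {t : ℕ} (ht : t ≤ n) : (varIdeal K n t).height = t := by
  classical
  refine le_antisymm ?_ ?_
  · have h : varIdeal K n t = Ideal.span
        (((Finset.univ.filter fun j : Fin n => j.1 < t).image X : Finset (MvPolynomial (Fin n) K)) :
          Set (MvPolynomial (Fin n) K)) := by
      simp [varIdeal]
    refine (Ideal.height_le_card_of_mem_minimalPrimes_span_finset (p := varIdeal K n t)
      (s := (Finset.univ.filter fun j : Fin n => j.1 < t).image X) ?_).trans ?_
    · rw [← h, Ideal.minimalPrimes_eq_subsingleton_self]; rfl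
    · refine Nat.cast_le.2 (Finset.card_image_le.trans ?_)
      rw [Fin.card_filter_val_lt]
      exact min_le_right _ _
  · induction t with
    | zero => simp
    | succ t ih =>
      push_cast
      exact (add_le_add_left (ih (by omega)) 1).trans
        (Ideal.height_add_one_le_of_lt_of_isPrime (varIdeal_lt_varIdeal (Nat.lt_succ_self t) ht))

end VarIdeal

/-! ### The irreducible ideals are primary -/

section Saturation

variable {K : Type*} [Field K] {n : ℕ}

lemma ExpTuple.lt_t_iff {a : ExpTuple n} {j : Fin n} : j.1 < a.t ↔ j ≤ a.1 := Nat.lt_succ_iff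

lemma ExpTuple.t_le (a : ExpTuple n) : a.t ≤ n := a.1.2

lemma monomial_mul_mem_irredIdeal_iff {a : ExpTuple n} {f : MvPolynomial (Fin n) K}
    {w : Fin n →₀ ℕ} :
    monomial w 1 * f ∈ irredIdeal K a ↔ ∀ u ∈ f.support, w + u ∉ a.box := by
  rw [mem_irredIdeal_iff]
  have : (monomial w 1 * f).support = f.support.map (addLeftEmbedding w) := by
    ext u
    simp only [mem_support_iff, coeff_monomial_mul', Finset.mem_map, addLeftEmbedding_apply]
    constructor
    · intro h
      split_ifs at h with hw
      · exact ⟨u - w, by simpa using h, add_tsub_cancel_of_le hw⟩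
      · simp at h
    · rintro ⟨v, hv, rfl⟩
      simpa using hv
  simp [this]

/-- A polynomial outside `𝔪^a` has a monomial multiple in the socle of `S / 𝔪^a`. -/
lemma exists_monomial_mul_mem_socle {a : ExpTuple n} {g : MvPolynomial (Fin n) K}
    (hg : g ∉ irredIdeal K a) :
    ∃ w : Fin n →₀ ℕ, monomial w 1 * g ∉ irredIdeal K a ∧
      ∀ r ∈ varIdeal K n a.t, r * (monomial w 1 * g) ∈ irredIdeal K a := by
  classical
  -- Choose `u` of least degree in the first `t` variables; `w` lifts it there to the top exponents
  -- `a_j - 1`. Any other term that survives multiplication by `x^w` and one more `x_j` would have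
  -- smaller such degree.
  obtain ⟨u, hu, hmin⟩ := (g.support.filter (· ∈ a.box)).exists_min_image
    (fun u => ∑ j ∈ Finset.Iic a.1, u j) (by
      rw [mem_irredIdeal_iff] at hg
      push Not at hg
      obtain ⟨u, hu, hua⟩ := hg
      exact ⟨u, by simp only [Finset.mem_filter]; exact ⟨hu, hua⟩⟩)
  simp only [Finset.mem_filter, and_imp] at hu hmin
  let w : Fin n →₀ ℕ := Finsupp.equivFunOnFinite.symm fun j =>
    if j ≤ a.1 then a.entry j - 1 - u j else 0
  have hw : ∀ j ≤ a.1, w j = a.entry j - 1 - u j := fun j hj => by simp [w, hj]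
  refine ⟨w, fun h => monomial_mul_mem_irredIdeal_iff.1 h u hu.1 fun j hj => ?_, fun r hr => ?_⟩
  · have := hu.2 j hj
    rw [Finsupp.add_apply, hw j hj]; omega
  · suffices ∀ j : Fin n, j.1 < a.t → X j * (monomial w 1 * g) ∈ irredIdeal K a by
      refine Submodule.span_induction ?_ (by simp) (fun x y _ _ hx hy => ?_)
        (fun x y _ hy => ?_) hr
      · rintro _ ⟨j, hj, rfl⟩; exact this j hj
      · rw [add_mul]; exact add_mem hx hy
      · rw [smul_eq_mul, mul_assoc]; exact Ideal.mul_mem_left _ _ hy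
    intro j hj
    rw [ExpTuple.lt_t_iff] at hj
    have hX : (X j : MvPolynomial (Fin n) K) = monomial (Finsupp.single j 1) 1 := rfl
    rw [← mul_assoc, hX, monomial_mul, mul_one, monomial_mul_mem_irredIdeal_iff]
    intro v hv hbox
    have hle : ∀ i ≤ a.1, v i ≤ u i := fun i hi => by
      have h1 := hbox i hi
      have h2 := hu.2 i hi
      simp only [Finsupp.add_apply, hw i hi] at h1
      omega
    have hlt : v j < u j := by
      have h1 := hbox j hj
      have h2 := hu.2 j hj
      simp only [Finsupp.add_apply, hw j hj, Finsupp.single_eq_same] at h1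
      omega
    refine (hmin v hv fun i hi => (hle i hi).trans_lt (hu.2 i hi)).not_gt ?_
    exact Finset.sum_lt_sum (fun i hi => hle i (Finset.mem_Iic.1 hi)) ⟨j, Finset.mem_Iic.2 hj, hlt⟩

/-- The ideal `𝔪^a` is `(x₁, …, x_t)`-primary. -/
lemma mem_irredIdeal_of_mul_mem {a : ExpTuple n} {s g : MvPolynomial (Fin n) K}
    (hs : s ∉ varIdeal K n a.t) (h : s * g ∈ irredIdeal K a) : g ∈ irredIdeal K a := by
  classical
  by_contra hg
  obtain ⟨w, hw, hsoc⟩ := exists_monomial_mul_mem_socle hg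
  set f := monomial w 1 * g
  -- On the socle element `f`, multiplication by `s` agrees modulo `𝔪^a` with multiplication by `p`,
  -- which involves only variables beyond `x_t`.
  set p := rename Subtype.val (killVars K n a.t s) with hp
  have hp0 : p ≠ 0 := fun h0 => hs <| by
    have := sub_rename_killVars_mem a.t s
    rwa [← hp, h0, sub_zero] at this
  have hpf : p * f ∈ irredIdeal K a := by
    have h1 : s * f ∈ irredIdeal K a := by
      rw [show s * f = monomial w 1 * (s * g) by ring]
      exact Ideal.mul_mem_left _ _ h
    have h2 := hsoc _ (sub_rename_killVars_mem a.t s)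
    rw [← hp, sub_mul] at h2
    simpa using sub_mem h1 h2
  -- Discard the terms of `f` in `𝔪^a`. Since `p` does not touch the first `t` exponents, every term
  -- of `p * f₀` stays in the box, yet the product is nonzero and lies in `𝔪^a`.
  set f₀ := ∑ u ∈ f.support with u ∈ a.box, monomial u (coeff u f) with hf₀
  have hcoeff : ∀ u, coeff u f₀ = if u ∈ a.box then coeff u f else 0 := fun u => by
    simp only [hf₀, coeff_sum, coeff_monomial, Finset.sum_ite_eq', Finset.mem_filter,
      mem_support_iff]
    split_ifs <;> simp_all
  have hf₀0 : f₀ ≠ 0 := fun h0 => hw <| mem_irredIdeal_iff.2 fun u hu hua => by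
    have := hcoeff u
    rw [h0, coeff_zero, if_pos hua] at this
    exact mem_support_iff.1 hu this.symm
  have hsub : f - f₀ ∈ irredIdeal K a := mem_irredIdeal_iff.2 fun u hu hua => by
    rw [mem_support_iff, coeff_sub, hcoeff, if_pos hua, sub_self] at hu
    exact hu rfl
  have hpf₀ : p * f₀ ∈ irredIdeal K a := by
    have := sub_mem hpf (Ideal.mul_mem_left _ p hsub)
    rwa [← mul_sub, sub_sub_cancel] at this
  obtain ⟨v, hv⟩ := support_nonempty.2 (mul_ne_zero hp0 hf₀0)
  refine mem_irredIdeal_iff.1 hpf₀ v hv ?_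
  obtain ⟨x, hx, y, hy, rfl⟩ := Finset.mem_add.1 (support_mul _ _ hv)
  have hya : y ∈ a.box := by
    by_contra hya
    rw [mem_support_iff, hcoeff, if_neg hya] at hy
    exact hy rfl
  intro j hj
  have hxj : x j = 0 := by
    rw [hp, support_rename_of_injective Subtype.val_injective, Finset.mem_image] at hx
    obtain ⟨z, -, rfl⟩ := hx
    refine Finsupp.mapDomain_of_notMem_range _ _ ?_
    rintro ⟨i, rfl⟩
    exact i.2.not_gt (ExpTuple.lt_t_iff.2 hj)
  rw [Finsupp.add_apply, hxj, zero_add]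
  exact hya j hj

lemma irredIdeal_le_varIdeal (a : ExpTuple n) : irredIdeal K a ≤ varIdeal K n a.t := by
  refine Ideal.span_le.2 ?_
  rintro _ ⟨j, rfl⟩
  exact Ideal.pow_mem_of_mem _ (X_mem_varIdeal_iff.2 (show (Fin.castLE a.1.isLt j).1 < a.t from j.2)) _
    (a.2 j).pos

lemma exists_varIdeal_pow_le (a : ExpTuple n) : ∃ N, varIdeal K n a.t ^ N ≤ irredIdeal K a := by
  refine Ideal.exists_pow_le_of_le_radical_of_fg (Ideal.span_le.2 ?_)
    (Submodule.fg_span (Set.toFinite _))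
  rintro _ ⟨j, hj, rfl⟩
  exact ⟨a.2 ⟨j.1, hj⟩, Ideal.subset_span ⟨⟨j.1, hj⟩, rfl⟩⟩

end Saturation

/-! ### Associated primes and height -/

section AssociatedPrimes

variable {K : Type*} [Field K] {n : ℕ} {I : Ideal (MvPolynomial (Fin n) K)}
  {E : Finset (ExpTuple n)}

lemma mem_colon_mk_iff {R : Type*} [CommRing R] {I : Ideal R} {g r : R} :
    r ∈ Submodule.colon (⊥ : Submodule R (R ⧸ I)) {Ideal.Quotient.mk I g} ↔ r * g ∈ I := by
  rw [Submodule.mem_colon_singleton, Submodule.mem_bot, ← Ideal.Quotient.eq_zero_iff_mem, map_mul]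
  rfl

lemma IsIrredundantDecomposition.mem_iff_forall (hE : IsIrredundantDecomposition I E)
    {f : MvPolynomial (Fin n) K} : f ∈ I ↔ ∀ a ∈ E, f ∈ irredIdeal K a := by
  rw [hE.1]; simp only [Ideal.mem_iInf]

lemma IsIrredundantDecomposition.isAssociatedPrime_iff (hE : IsIrredundantDecomposition I E)
    {p : Ideal (MvPolynomial (Fin n) K)} :
    p ∈ associatedPrimes (MvPolynomial (Fin n) K) (MvPolynomial (Fin n) K ⧸ I) ↔
      ∃ a ∈ E, p = varIdeal K n a.t := by
  classical
  rw [AssociatedPrimes.mem_iff, _root_.isAssociatedPrime_iff]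
  constructor
  · rintro ⟨hp, x, hx⟩
    obtain ⟨g, rfl⟩ := Ideal.Quotient.mk_surjective x
    have hpg : ∀ r, r ∈ p ↔ r * g ∈ I := fun r => by rw [hx, mem_colon_mk_iff]
    -- Some colon ideal `𝔪^a : g` lies in the prime `p = I : g`: otherwise a product of elements of
    -- these colons outside `p` would lie in `I : g`.
    obtain ⟨a, ha, hap⟩ : ∃ a ∈ E, ∀ r, r * g ∈ irredIdeal K a → r ∈ p := by
      by_contra! h
      choose! r hr hrp using h
      have : ∏ a ∈ E, r a ∈ p := by
        rw [hpg, hE.mem_iff_forall]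
        intro a ha
        rw [← Finset.mul_prod_erase _ _ ha, mul_right_comm]
        exact Ideal.mul_mem_right _ _ (hr a ha)
      obtain ⟨a, ha, h⟩ := (hp.prod_mem_iff).1 this
      exact hrp a ha h
    have hg : g ∉ irredIdeal K a := fun h =>
      hp.ne_top ((Ideal.eq_top_iff_one _).2 (hap 1 (by rwa [one_mul])))
    refine ⟨a, ha, le_antisymm (fun r hr => ?_) ?_⟩
    · by_contra hra
      exact hg (mem_irredIdeal_of_mul_mem hra (hE.mem_iff_forall.1 ((hpg r).1 hr) a ha))
    · obtain ⟨N, hN⟩ := exists_varIdeal_pow_le (K := K) a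
      refine hp.le_of_pow_le (hN.trans fun r hr => hap r (Ideal.mul_mem_right _ _ hr))
  · rintro ⟨a, ha, rfl⟩
    refine ⟨inferInstance, ?_⟩
    -- Irredundancy gives an element of all other components outside `𝔪^a`; a socle multiple of it
    -- has annihilator exactly `P_{t(a)}` in `S/I`.
    obtain ⟨g, hg, hga⟩ := SetLike.not_le_iff_exists.1 (hE.not_iInf_erase_le ha)
    obtain ⟨w, hw, hsoc⟩ := exists_monomial_mul_mem_socle hga
    refine ⟨Ideal.Quotient.mk I (monomial w 1 * g), Ideal.ext fun r => ?_⟩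
    rw [mem_colon_mk_iff]
    refine ⟨fun hr => hE.mem_iff_forall.2 fun b hb => ?_, fun hr => ?_⟩
    · by_cases hba : b = a
      · rw [hba]; exact hsoc r hr
      · simp only [Ideal.mem_iInf] at hg
        exact Ideal.mul_mem_left _ _ (Ideal.mul_mem_left _ _
          (hg b (Finset.mem_erase.2 ⟨hba, hb⟩)))
    · by_contra hra
      exact hw (mem_irredIdeal_of_mul_mem hra (hE.mem_iff_forall.1 hr a ha))

/-- The height of an intersection of irreducible monomial ideals is the smallest length of the
tuples. -/
lemma IsIrredundantDecomposition.height_eq (hE : IsIrredundantDecomposition I E)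
    {a : ExpTuple n} (ha : a ∈ E) (hmin : ∀ b ∈ E, a.t ≤ b.t) : I.height = a.t := by
  refine le_antisymm ?_ ?_
  · rw [← height_varIdeal (K := K) a.t_le]
    exact Ideal.height_mono ((hE.1.trans_le (iInf₂_le a ha)).trans (irredIdeal_le_varIdeal a))
  · rw [Ideal.height_eq_inf_minimalPrimes]
    refine le_iInf₂ fun p hp => ?_
    have hp' := hp.isPrime
    obtain ⟨b, hb, hbp⟩ : ∃ b ∈ E, irredIdeal K b ≤ p := by
      rw [← hp'.inf_le', Finset.inf_eq_iInf, ← hE.1]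
      exact hp.1.2
    obtain ⟨N, hN⟩ := exists_varIdeal_pow_le (K := K) b
    calc (a.t : ℕ∞) ≤ b.t := by exact_mod_cast hmin b hb
      _ = (varIdeal K n b.t).height := (height_varIdeal b.t_le).symm
      _ ≤ p.height := Ideal.height_mono (hp'.le_of_pow_le (hN.trans hbp))

end AssociatedPrimes

/-! ### Hilbert functions and degree from a Stanley decomposition -/

section Hilbert

variable {K : Type*} [Field K] {n : ℕ}

/-- For an ideal `I` whose elements are characterized by their supports, the Hilbert function of
`S/I` counts the monomials outside `I`. -/
lemma hilbertFunction_eq_card {I : Ideal (MvPolynomial (Fin n) K)} {A : Set (Fin n →₀ ℕ)}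
    (hI : ∀ f, f ∈ I ↔ ∀ u ∈ f.support, u ∉ A) (k : ℕ) :
    hilbertFunction I k = Nat.card {u : Fin n →₀ ℕ // u.degree = k ∧ u ∈ A} := by
  classical
  let v : {u : Fin n →₀ ℕ // u.degree = k ∧ u ∈ A} → MvPolynomial (Fin n) K ⧸ I :=
    fun u => Ideal.Quotient.mkₐ K I (monomial u.1 1)
  have hspan : (homogeneousSubmodule (Fin n) K k).map (Ideal.Quotient.mkₐ K I).toLinearMap =
      Submodule.span K (Set.range v) := by
    refine le_antisymm ?_ (Submodule.span_le.2 ?_)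
    · rintro _ ⟨f, hf, rfl⟩
      rw [f.as_sum, map_sum]
      refine Submodule.sum_mem _ fun u hu => ?_
      have hdeg : u.degree = k := by
        by_contra h
        exact mem_support_iff.1 hu (IsHomogeneous.coeff_eq_zero hf h)
      rw [← mul_one (coeff u f), ← smul_eq_mul, ← smul_monomial, map_smul]
      refine Submodule.smul_mem _ _ ?_
      by_cases hA : u ∈ A
      · exact Submodule.subset_span ⟨⟨u, hdeg, hA⟩, rfl⟩
      · convert Submodule.zero_mem _
        refine Ideal.Quotient.eq_zero_iff_mem.2 ((hI _).2 fun w hw => ?_)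
        rwa [Finset.mem_singleton.1 (support_monomial_subset hw)]
    · rintro _ ⟨u, rfl⟩
      exact ⟨monomial u.1 1, isHomogeneous_monomial _ u.2.1, rfl⟩
  have hfin : Finite {u : Fin n →₀ ℕ // u.degree = k ∧ u ∈ A} := by
    refine Set.Finite.subset (Finset.finite_toSet (Finset.univ.finsuppAntidiag k)) ?_
    rintro u ⟨hu, -⟩
    rw [Finsupp.degree_eq_sum] at hu
    simpa using hu
  have := Fintype.ofFinite {u : Fin n →₀ ℕ // u.degree = k ∧ u ∈ A}
  have hlin : LinearIndependent K v := by
    rw [Fintype.linearIndependent_iff]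
    intro g hg i
    have hmem : ∑ u, monomial u.1 (g u) ∈ I := by
      rw [← Ideal.Quotient.eq_zero_iff_mem, ← hg, map_sum]
      refine Finset.sum_congr rfl fun u _ => ?_
      change Ideal.Quotient.mkₐ K I _ = g u • Ideal.Quotient.mkₐ K I _
      rw [← map_smul, smul_monomial, smul_eq_mul, mul_one]
    have hc : coeff i.1 (∑ u, monomial u.1 (g u)) = g i := by
      rw [coeff_sum, Finset.sum_eq_single i]
      · simp
      · intro b _ hb
        rw [coeff_monomial, if_neg fun h => hb (Subtype.ext h)]
      · simp
    by_contra h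
    exact (hI _).1 hmem i.1 (mem_support_iff.2 (hc ▸ h)) i.2.2
  rw [hilbertFunction, hspan, finrank_span_eq_card hlin, Nat.card_eq_fintype_card]

/-- The number of exponents of degree at most `k` in a cone. -/
lemma card_cone_degree_le {s : Fin n} {c : Fin n →₀ ℕ} (hc : ∀ j, s < j → c j = 0) {k : ℕ}
    (hk : c.degree ≤ k) :
    Nat.card {u : Fin n →₀ ℕ // u.degree ≤ k ∧ u ∈ cone s c} =
      (k - c.degree + (n - (s.1 + 1))).choose (n - (s.1 + 1)) := by
  classical
  have hcard := Finset.card_finsuppAntidiag_nat_eq_choose (s := Finset.Ici s) (k - c.degree)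
  rw [Fin.card_Ici, show n - s.1 + (k - c.degree) - 1 = k - c.degree + (n - (s.1 + 1)) by
    have := s.2; omega, Nat.choose_symm_add] at hcard
  rw [← hcard, ← Nat.card_eq_finsetCard]
  have hle : ∀ u ∈ cone s c, c ≤ u := fun u hu j => by
    rcases le_or_gt j s with hj | hj
    · exact (hu j hj).ge
    · rw [hc j hj]; exact Nat.zero_le _
  have hmem : ∀ f : Fin n →₀ ℕ, f ∈ (Finset.Ici s).finsuppAntidiag (k - c.degree) ↔
      f.degree = k - c.degree ∧ ∀ j < s, f j = 0 := fun f => by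
    rw [Finset.mem_finsuppAntidiag']
    change f.degree = _ ∧ _ ↔ _
    refine and_congr_right' ⟨fun h j hj => ?_, fun h j hj => ?_⟩
    · by_contra h0
      exact (Finset.mem_Ici.1 (h (Finsupp.mem_support_iff.2 h0))).not_gt hj
    · exact Finset.mem_Ici.2 (le_of_not_gt fun h0 => Finsupp.mem_support_iff.1 hj (h j h0))
  have hsplit : ∀ f : Fin n →₀ ℕ, f.degree = f s + (f.erase s).degree := fun f => by
    conv_lhs => rw [← Finsupp.single_add_erase s f, map_add, Finsupp.degree_single]
  have hsub : ∀ u ∈ cone s c, (u - c).degree + c.degree = u.degree := fun u hu => by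
    rw [← map_add, tsub_add_cancel_of_le (hle u hu)]
  -- The slack `k - deg u` is stored in coordinate `s`, where `u - c` vanishes. This turns degree at
  -- most `k` into degree exactly `k - deg c` in the coordinates from `s` on.
  refine Nat.card_congr
    { toFun := fun u => ⟨(u.1 - c) + Finsupp.single s (k - u.1.degree), ?_⟩
      invFun := fun f => ⟨c + f.1.erase s, ?_, ?_⟩
      left_inv := fun u => Subtype.ext ?_
      right_inv := fun f => Subtype.ext ?_ }
  · obtain ⟨u, hu, huc⟩ := u
    refine (hmem _).2 ⟨?_, fun j hj => ?_⟩
    · have := hsub u huc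
      rw [map_add, Finsupp.degree_single]
      dsimp only
      omega
    · simp [huc j hj.le, hj.ne]
  · have h1 := ((hmem _).1 f.2).1
    have h2 := hsplit f.1
    rw [map_add]; omega
  · intro j hj
    rcases hj.lt_or_eq with hj | rfl
    · simp [hj.ne, ((hmem _).1 f.2).2 j hj]
    · simp
  · obtain ⟨u, hu, huc⟩ := u
    ext j
    by_cases hj : j = s
    · subst hj; simp [huc j le_rfl]
    · have := hle u huc j
      simp [hj]; omega
  · obtain ⟨f, hf⟩ := f
    ext j
    by_cases hj : j = s
    · subst hj
      have h1 := ((hmem _).1 hf).1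
      have h2 := hsplit f
      simp only [map_add, add_tsub_cancel_left, Finsupp.add_apply, Finsupp.erase_same,
        Finsupp.single_eq_same]
      omega
    · simp [hj]

/-- A polynomial that counts monomials determines the degree. -/
lemma degree_eq_of_isHilbertSamuelPoly {I : Ideal (MvPolynomial (Fin n) K)} {P : Polynomial ℚ}
    (hP : IsHilbertSamuelPoly I P) : degree I = (P.natDegree.factorial : ℚ) * P.leadingCoeff := by
  have h : ∃ P, IsHilbertSamuelPoly I P := ⟨P, hP⟩
  have heq : h.choose = P := by
    refine Polynomial.eq_of_infinite_eval_eq _ _ ?_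
    obtain ⟨N, hN⟩ := Filter.eventually_atTop.1 (hP.and h.choose_spec)
    refine Set.Infinite.mono (s := (Nat.cast : ℕ → ℚ) '' Set.Ici N) ?_
      ((Set.Ici_infinite N).image Nat.cast_injective.injOn)
    rintro _ ⟨k, hk, rfl⟩
    exact (hN k hk).2.symm.trans (hN k hk).1
  rw [degree, dif_pos h, heq]

/-- A cone contributes a binomial polynomial of degree `d = n - (s i + 1)` with leading coefficient
`1/d!`. These are positive, so nothing cancels, and only the cones with `s i = s₀` reach the top
degree. -/
lemma degree_eq_card_of_stanley {I : Ideal (MvPolynomial (Fin n) K)} {A : Set (Fin n →₀ ℕ)}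
    (hI : ∀ f, f ∈ I ↔ ∀ u ∈ f.support, u ∉ A) {ι : Type*} (T : Finset ι) (s : ι → Fin n)
    (c : ι → Fin n →₀ ℕ) (hc : ∀ i ∈ T, ∀ j, s i < j → c i j = 0)
    (hA : ∀ u, u ∈ A ↔ ∃ i ∈ T, u ∈ cone (s i) (c i))
    (hdisj : ∀ u, ∀ i ∈ T, ∀ j ∈ T, u ∈ cone (s i) (c i) → u ∈ cone (s j) (c j) → i = j)
    {s₀ : Fin n} (hs₀ : ∃ i ∈ T, s i = s₀) (hmin : ∀ i ∈ T, s₀ ≤ s i) :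
    degree I = (T.filter fun i => s i = s₀).card := by
  classical
  set P : Polynomial ℚ := ∑ i ∈ T, Polynomial.preHilbertPoly ℚ (n - ((s i).1 + 1)) (c i).degree
    with hPdef
  have hP : IsHilbertSamuelPoly I P := by
    refine Filter.eventually_atTop.2 ⟨T.sup fun i => (c i).degree, fun k hk => ?_⟩
    rw [hPdef, Polynomial.eval_finsetSum]
    have h1 : ∑ j ∈ Finset.range (k + 1), hilbertFunction I j =
        ∑ i ∈ T, Nat.card {u : Fin n →₀ ℕ // u.degree ≤ k ∧ u ∈ cone (s i) (c i)} := by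
      set U : Finset (Fin n →₀ ℕ) :=
        (Finset.range (k + 1)).biUnion fun j => Finset.univ.finsuppAntidiag j
      have hU : ∀ u, u ∈ U ↔ u.degree ≤ k := fun u => by
        simp [U, Finsupp.degree_eq_sum]
      have hl : ∀ j ∈ Finset.range (k + 1), hilbertFunction I j =
          ((U.filter (· ∈ A)).filter fun u => u.degree = j).card := fun j hj => by
        rw [hilbertFunction_eq_card hI]
        refine Nat.subtype_card _ fun u => ?_
        have := Finset.mem_range.1 hj
        simp only [Finset.mem_filter, hU]
        constructor
        · rintro ⟨⟨-, h1⟩, h2⟩; exact ⟨h2, h1⟩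
        · rintro ⟨h2, h1⟩; exact ⟨⟨by omega, h1⟩, h2⟩
      have hr : ∀ i ∈ T, Nat.card {u : Fin n →₀ ℕ // u.degree ≤ k ∧ u ∈ cone (s i) (c i)} =
          (U.filter (· ∈ cone (s i) (c i))).card := fun i _ =>
        Nat.subtype_card _ fun u => by rw [Finset.mem_filter, hU]
      rw [Finset.sum_congr rfl hl, Finset.sum_congr rfl hr,
        ← Finset.card_eq_sum_card_fiberwise, ← Finset.card_biUnion]
      · congr 1
        ext u
        simp only [Finset.mem_filter, Finset.mem_biUnion, hA]
        tauto
      · intro i hi j hj hij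
        refine Finset.disjoint_left.2 fun u hu hu' => hij ?_
        exact hdisj u i hi j hj (Finset.mem_filter.1 hu).2 (Finset.mem_filter.1 hu').2
      · intro u hu
        have := (hU u).1 (Finset.mem_filter.1 hu).1
        simpa [Nat.lt_succ_iff] using this
    rw [h1, Nat.cast_sum]
    refine Finset.sum_congr rfl fun i hi => ?_
    have hik : (c i).degree ≤ k := (Finset.le_sup (f := fun i => (c i).degree) hi).trans hk
    rw [card_cone_degree_le (hc i hi) hik, Polynomial.preHilbertPoly_eq_choose_sub_add ℚ _ hik]
  have hcoeff : P.coeff (n - (s₀.1 + 1)) =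
      (T.filter fun i => s i = s₀).card * ((n - (s₀.1 + 1)).factorial : ℚ)⁻¹ := by
    rw [hPdef, Polynomial.finsetSum_coeff, Finset.card_filter, Nat.cast_sum, Finset.sum_mul]
    refine Finset.sum_congr rfl fun i hi => ?_
    split_ifs with h
    · rw [h, Polynomial.coeff_preHilbertPoly_self, Nat.cast_one, one_mul]
    · rw [Nat.cast_zero, zero_mul, Polynomial.coeff_eq_zero_of_natDegree_lt]
      rw [Polynomial.natDegree_preHilbertPoly]
      have h1 := lt_of_le_of_ne (hmin i hi) (Ne.symm h)
      have h2 := (s i).2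
      have h3 : s₀.1 < (s i).1 := h1
      omega
  have hfact : ((n - (s₀.1 + 1)).factorial : ℚ) ≠ 0 := by positivity
  have hpos : ((T.filter fun i => s i = s₀).card : ℚ) ≠ 0 := by
    obtain ⟨i, hi, h⟩ := hs₀
    exact_mod_cast (Finset.card_pos.2 ⟨i, Finset.mem_filter.2 ⟨hi, h⟩⟩).ne'
  have hdeg : P.natDegree = n - (s₀.1 + 1) := by
    refine le_antisymm (Polynomial.natDegree_sum_le_of_forall_le _ _ fun i hi => ?_)
      (Polynomial.le_natDegree_of_ne_zero ?_)
    · rw [Polynomial.natDegree_preHilbertPoly]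
      have : s₀.1 ≤ (s i).1 := hmin i hi
      omega
    · rw [hcoeff]; exact mul_ne_zero hpos (inv_ne_zero hfact)
  rw [degree_eq_of_isHilbertSamuelPoly hP, Polynomial.leadingCoeff, hdeg, hcoeff]
  field_simp

end Hilbert

/-! ### Lengths over local rings and localized quotients -/

section LocalLength

/-- A submodule covering another one has length one more. -/
lemma length_eq_add_one_of_covBy {R M : Type*} [CommRing R] [AddCommGroup M] [Module R M]
    {p q : Submodule R M} (h : p ⋖ q) : Module.length R q = Module.length R p + 1 := by
  let f : p →ₗ[R] q := Submodule.inclusion h.le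
  have key : IsSimpleModule R (q ⧸ LinearMap.range f) := by
    rwa [Submodule.range_inclusion, ← covBy_iff_quot_is_simple h.le]
  rw [Module.length_eq_add_of_exact f (LinearMap.range f).mkQ (Submodule.inclusion_injective h.le)
    (Submodule.mkQ_surjective _) (LinearMap.exact_map_mkQ_range f), Module.length_eq_one_iff.2 key]

/-- Over a local ring, a finite family of generators, each outside the span of the others of no
smaller weight and moved by the maximal ideal into the span of those of larger weight, has as many
members as the length of its span. -/
lemma length_span_image_eq_card {R M ι : Type*} [CommRing R] [IsLocalRing R] [AddCommGroup M]
    [Module R M] [DecidableEq ι] (x : ι → M) (d : ι → ℕ) (s : Finset ι)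
    (h1 : ∀ i ∈ s, ∀ r ∈ IsLocalRing.maximalIdeal R,
      r • x i ∈ Submodule.span R (x '' {j | j ∈ s ∧ d i < d j}))
    (h2 : ∀ i ∈ s, x i ∉ Submodule.span R (x '' {j | j ∈ s ∧ j ≠ i ∧ d i ≤ d j})) :
    Module.length R (Submodule.span R (x '' s)) = s.card := by
  -- The generator of least weight is added last: the maximal ideal moves it into the span of the
  -- others, which does not contain it, so each step is a covering.
  induction s using Finset.induction_on_min_value d with
  | empty =>
    rw [Finset.coe_empty, Set.image_empty, Submodule.span_empty, Finset.card_empty]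
    exact Module.length_bot
  | insert a s ha hmin ih =>
    have hlt : ∀ i ∈ insert a s, {j | j ∈ insert a s ∧ d i < d j} ⊆ {j | j ∈ s ∧ d i < d j} := by
      rintro i hi j ⟨hj, hij⟩
      refine ⟨(Finset.mem_insert.1 hj).resolve_left fun h => ?_, hij⟩
      rcases Finset.mem_insert.1 hi with rfl | hi
      · exact hij.ne (h ▸ rfl)
      · exact (hmin i hi).not_gt (h ▸ hij)
    have ih' := ih
      (fun i hi r hr => Submodule.span_mono (Set.image_mono (hlt i (Finset.mem_insert_of_mem hi)))
        (h1 i (Finset.mem_insert_of_mem hi) r hr))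
      (fun i hi h => h2 i (Finset.mem_insert_of_mem hi)
        (Submodule.span_mono (Set.image_mono (t := {j | j ∈ insert a s ∧ j ≠ i ∧ d i ≤ d j})
          fun j hj => ⟨Finset.mem_insert_of_mem hj.1, hj.2⟩) h))
    have hm : ∀ r ∈ IsLocalRing.maximalIdeal R, r • x a ∈ Submodule.span R (x '' s) :=
      fun r hr => Submodule.span_mono
        (Set.image_mono fun j hj => (hlt a (Finset.mem_insert_self _ _) hj).1)
        (h1 a (Finset.mem_insert_self _ _) r hr)
    have hxa : x a ∉ Submodule.span R (x '' s) := fun h =>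
      h2 a (Finset.mem_insert_self _ _) (Submodule.span_mono (Set.image_mono
        (t := {j | j ∈ insert a s ∧ j ≠ a ∧ d a ≤ d j}) fun j hj =>
          ⟨Finset.mem_insert_of_mem hj, fun h => ha (h ▸ hj), hmin j hj⟩) h)
    have hins : Submodule.span R (x '' (insert a s : Finset ι)) =
        Submodule.span R {x a} ⊔ Submodule.span R (x '' s) := by
      rw [Finset.coe_insert, Set.image_insert_eq, Submodule.span_insert]
    rw [Finset.card_insert_of_notMem ha, hins, Nat.cast_add, ← ih', Nat.cast_one]
    refine length_eq_add_one_of_covBy ⟨lt_of_le_of_ne le_sup_right fun h => hxa ?_, ?_⟩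
    · rw [h]; exact Submodule.mem_sup_left (Submodule.mem_span_singleton_self _)
    · intro L hL hL'
      obtain ⟨y, hyL, hy⟩ := SetLike.exists_of_lt hL
      refine hL'.not_ge (sup_le ?_ hL.le)
      obtain ⟨y₁, hy₁, z, hz, rfl⟩ := Submodule.mem_sup.1 (hL'.le hyL)
      obtain ⟨r, rfl⟩ := Submodule.mem_span_singleton.1 hy₁
      have hr : IsUnit r := by
        by_contra hr
        exact hy (add_mem (hm r ((IsLocalRing.mem_maximalIdeal r).2 hr)) hz)
      rw [Submodule.span_singleton_le_iff_mem]
      have : r • x a ∈ L := by simpa using sub_mem hyL (hL.le hz)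
      exact (Submodule.smul_mem_iff_of_isUnit L hr).1 this

variable {S : Type*} [CommRing S] (P : Ideal S) [P.IsPrime] (I : Ideal S)

/-- The canonical map from `S` to the localization of `S/I` at `P`. -/
noncomputable def toLocalizedQuotient : S →ₗ[S] LocalizedModule P.primeCompl (S ⧸ I) :=
  (LocalizedModule.mkLinearMap P.primeCompl (S ⧸ I)).comp I.mkQ

variable {P I}

lemma toLocalizedQuotient_eq_zero_iff {f : S} :
    toLocalizedQuotient P I f = 0 ↔ ∃ s ∉ P, s * f ∈ I := by
  rw [toLocalizedQuotient, LinearMap.comp_apply,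
    IsLocalizedModule.eq_zero_iff P.primeCompl (LocalizedModule.mkLinearMap P.primeCompl (S ⧸ I))]
  constructor
  · rintro ⟨s, hs⟩
    refine ⟨s.1, s.2, ?_⟩
    rw [← Ideal.Quotient.eq_zero_iff_mem]
    exact hs
  · rintro ⟨s, hs, h⟩
    exact ⟨⟨s, hs⟩, Ideal.Quotient.eq_zero_iff_mem.2 h⟩

lemma exists_smul_eq_toLocalizedQuotient (y : LocalizedModule P.primeCompl (S ⧸ I)) :
    ∃ s ∉ P, ∃ f, s • y = toLocalizedQuotient P I f := by
  obtain ⟨⟨m, s⟩, hs⟩ := IsLocalizedModule.surj P.primeCompl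
    (LocalizedModule.mkLinearMap P.primeCompl (S ⧸ I)) y
  obtain ⟨f, rfl⟩ := Ideal.Quotient.mk_surjective m
  exact ⟨s.1, s.2, f, hs⟩

lemma mem_of_smul_mem_of_notMem {M : Type*} [AddCommGroup M] [Module S M]
    [Module (Localization.AtPrime P) M] [IsScalarTower S (Localization.AtPrime P) M]
    (N : Submodule (Localization.AtPrime P) M) {s : S} (hs : s ∉ P) {y : M} (h : s • y ∈ N) :
    y ∈ N := by
  rw [← algebraMap_smul (Localization.AtPrime P) s y] at h
  exact (Submodule.smul_mem_iff_of_isUnit N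
    (IsLocalization.map_units (Localization.AtPrime P) (⟨s, hs⟩ : P.primeCompl))).1 h

/-- Clearing denominators turns membership in a span over the local ring into a congruence modulo
`I` in `S`, where supports can be compared. -/
lemma exists_mul_sub_mem_of_mem_span {T : Set S} {f : S}
    (h : toLocalizedQuotient P I f ∈
      Submodule.span (Localization.AtPrime P) (toLocalizedQuotient P I '' T)) :
    ∃ s ∉ P, ∃ g ∈ Ideal.span T, s * f - g ∈ I := by
  have key : ∀ y ∈ Submodule.span (Localization.AtPrime P) (toLocalizedQuotient P I '' T),
      ∃ s ∉ P, ∃ g ∈ Ideal.span T, s • y = toLocalizedQuotient P I g := by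
    intro y hy
    induction hy using Submodule.span_induction with
    | mem y hy =>
      obtain ⟨g, hg, rfl⟩ := hy
      exact ⟨1, P.one_notMem, g, Ideal.subset_span hg, one_smul _ _⟩
    | zero => exact ⟨1, P.one_notMem, 0, zero_mem _, by simp⟩
    | add y z _ _ hy hz =>
      obtain ⟨s, hs, g, hg, h⟩ := hy
      obtain ⟨s', hs', g', hg', h'⟩ := hz
      refine ⟨s * s', P.primeCompl.mul_mem hs hs', s' * g + s * g',
        add_mem (Ideal.mul_mem_left _ _ hg) (Ideal.mul_mem_left _ _ hg'), ?_⟩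
      rw [smul_add, mul_smul, mul_smul, smul_comm s s' y, h, h', map_add, ← smul_eq_mul,
        ← smul_eq_mul, map_smul, map_smul]
    | smul r y _ hy =>
      obtain ⟨s, hs, g, hg, h⟩ := hy
      obtain ⟨⟨a, b⟩, hb⟩ := IsLocalization.surj P.primeCompl r
      refine ⟨b.1 * s, P.primeCompl.mul_mem b.2 hs, a * g, Ideal.mul_mem_left _ _ hg, ?_⟩
      rw [mul_smul, smul_comm s r y, h, ← algebraMap_smul (Localization.AtPrime P) b.1, ← mul_smul,
        mul_comm, hb, algebraMap_smul, ← smul_eq_mul, map_smul]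
  obtain ⟨s, hs, g, hg, h⟩ := key _ h
  rw [← map_smul, ← sub_eq_zero, ← map_sub, toLocalizedQuotient_eq_zero_iff] at h
  obtain ⟨s', hs', h'⟩ := h
  refine ⟨s' * s, P.primeCompl.mul_mem hs' hs, s' * g, Ideal.mul_mem_left _ _ hg, ?_⟩
  rwa [mul_assoc, ← mul_sub]

lemma mem_zerothLocalCohomology_iff {R M : Type*} [CommRing R] [AddCommGroup M] [Module R M]
    {J : Ideal R} {y : M} :
    y ∈ zerothLocalCohomology J M ↔ ∃ k : ℕ, ∀ r ∈ J ^ k, r • y = 0 := by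
  rw [zerothLocalCohomology, Submodule.mem_iSup_of_directed]
  · simp [Submodule.mem_torsionBySet_iff]
  · refine Monotone.directed_le fun k l hkl => ?_
    exact Submodule.torsionBySet_le_torsionBySet_of_subset (Ideal.pow_le_pow_right hkl)

/-- The elements of the local ring at `P` in the `k`-th power of the maximal ideal kill the same
elements as `P ^ k`. -/
lemma forall_maximalIdeal_pow_smul_eq_zero_iff {M : Type*} [AddCommGroup M] [Module S M]
    [Module (Localization.AtPrime P) M] [IsScalarTower S (Localization.AtPrime P) M] {k : ℕ}
    {y : M} : (∀ r ∈ IsLocalRing.maximalIdeal (Localization.AtPrime P) ^ k, r • y = 0) ↔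
      ∀ r ∈ P ^ k, r • y = 0 := by
  rw [← Localization.AtPrime.map_eq_maximalIdeal, ← Ideal.map_pow]
  constructor
  · intro h r hr
    rw [← algebraMap_smul (Localization.AtPrime P)]
    exact h _ (Ideal.mem_map_of_mem _ hr)
  · intro h r hr
    induction hr using Submodule.span_induction with
    | mem r hr =>
      obtain ⟨r, hr, rfl⟩ := hr
      rw [algebraMap_smul]; exact h r hr
    | zero => simp
    | add a b _ _ ha hb => rw [add_smul, ha, hb, add_zero]
    | smul a b _ hb => rw [smul_eq_mul, mul_smul, hb, smul_zero]

lemma smul_mem_of_mem_maximalIdeal {M : Type*} [AddCommGroup M] [Module S M]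
    [Module (Localization.AtPrime P) M] [IsScalarTower S (Localization.AtPrime P) M]
    {N : Submodule (Localization.AtPrime P) M} {y : M} {T : Set S} (hT : P = Ideal.span T)
    (h : ∀ r ∈ T, r • y ∈ N) {r : Localization.AtPrime P}
    (hr : r ∈ IsLocalRing.maximalIdeal (Localization.AtPrime P)) : r • y ∈ N := by
  have hP : ∀ r ∈ P, r • y ∈ N := by
    intro r hr
    rw [hT] at hr
    induction hr using Submodule.span_induction with
    | mem r hr => exact h r hr
    | zero => rw [zero_smul]; exact zero_mem _
    | add a b _ _ iha ihb =>
      rw [add_smul]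
      exact add_mem iha ihb
    | smul a b _ ihb =>
      rw [smul_eq_mul, mul_smul]
      exact Submodule.smul_of_tower_mem _ _ ihb
  rw [← Localization.AtPrime.map_eq_maximalIdeal] at hr
  induction hr using Submodule.span_induction with
  | mem r hr =>
    obtain ⟨r, hr, rfl⟩ := hr
    rw [algebraMap_smul]; exact hP r hr
  | zero => rw [zero_smul]; exact zero_mem _
  | add a b _ _ ha hb => rw [add_smul]; exact add_mem ha hb
  | smul a b _ hb => rw [smul_eq_mul, mul_smul]; exact Submodule.smul_mem _ _ hb

end LocalLength

/-! ### The length multiplicities -/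

section Multiplicity

variable {K : Type*} [Field K] {n : ℕ} {I : Ideal (MvPolynomial (Fin n) K)}
  {E : Finset (ExpTuple n)}

lemma ExpTuple.mem_box_of_le {a : ExpTuple n} {u v : Fin n →₀ ℕ} (h : u ≤ v) (hv : v ∈ a.box) :
    u ∈ a.box := fun j hj => (h j).trans_lt (hv j hj)

/-- Components longer than `t` become trivial at `P_t`, since each contains a power of its last
variable, which lies outside `P_t`. The shorter or equal ones are primary to primes inside `P_t` and
survive unchanged. -/
lemma IsIrredundantDecomposition.toLocalizedQuotient_eq_zero_iff
    (hE : IsIrredundantDecomposition I E) {t : ℕ} {f : MvPolynomial (Fin n) K} :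
    toLocalizedQuotient (varIdeal K n t) I f = 0 ↔ ∀ a ∈ E, a.t ≤ t → f ∈ irredIdeal K a := by
  classical
  rw [StronglyStable.toLocalizedQuotient_eq_zero_iff]
  constructor
  · rintro ⟨s, hs, h⟩ a ha hat
    exact mem_irredIdeal_of_mul_mem (fun h' => hs (varIdeal_mono hat h')) (hE.mem_iff_forall.1 h a ha)
  · intro h
    refine ⟨∏ a ∈ E with t < a.t, X a.1 ^ a.entry a.1, fun hs => ?_,
      hE.mem_iff_forall.2 fun a ha => ?_⟩
    · obtain ⟨a, ha, h⟩ := ((varIdeal_isPrime t).prod_mem_iff).1 hs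
      have h1 := X_mem_varIdeal_iff.1 ((varIdeal_isPrime t).mem_of_pow_mem _ h)
      have h2 := (Finset.mem_filter.1 ha).2
      unfold ExpTuple.t at h2
      omega
    · rcases le_or_gt a.t t with hat | hat
      · exact Ideal.mul_mem_left _ _ (h a ha hat)
      · refine Ideal.mul_mem_right _ _ (Ideal.mem_of_dvd _
          (Finset.dvd_prod_of_mem _ (Finset.mem_filter.2 ⟨ha, hat⟩)) ?_)
        exact Ideal.subset_span ⟨Fin.last _, by rw [← ExpTuple.e_eq_entry]; rfl⟩

lemma toLocalizedQuotient_mul {S : Type*} [CommRing S] {P : Ideal S} [P.IsPrime] {I : Ideal S}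
    (f g : S) : toLocalizedQuotient P I (f * g) = f • toLocalizedQuotient P I g := by
  rw [← smul_eq_mul, map_smul]

/-- The pairs `(a, k)` with `a ∈ E` of length `s + 1` and `k < e(a)`. -/
def cornerPairs (E : Finset (ExpTuple n)) (s : Fin n) : Finset (Σ _ : ExpTuple n, ℕ) :=
  (E.filter fun a => a.1 = s).sigma fun a => Finset.range a.e

lemma mem_cornerPairs {s : Fin n} {i : Σ _ : ExpTuple n, ℕ} :
    i ∈ cornerPairs E s ↔ i.1 ∈ E ∧ i.1.1 = s ∧ i.2 < i.1.e := by
  simp [cornerPairs, and_assoc]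

lemma card_cornerPairs (E : Finset (ExpTuple n)) (s : Fin n) :
    (cornerPairs E s).card = ∑ a ∈ E with a.1 = s, a.e := by
  simp [cornerPairs]

lemma ExpTuple.mem_cone_corner (a : ExpTuple n) (k : ℕ) : a.corner k ∈ cone a.1 (a.corner k) :=
  fun _ _ => rfl

lemma ExpTuple.corner_le_of_mem_cone {a : ExpTuple n} {k : ℕ} {u : Fin n →₀ ℕ}
    (hu : u ∈ cone a.1 (a.corner k)) : a.corner k ≤ u := fun j => by
  rcases le_or_gt j a.1 with hj | hj
  · exact (hu j hj).ge
  · rw [a.corner_of_gt k hj]; exact Nat.zero_le _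

/-- Otherwise the covering would place this corner in a cone of a tuple no longer than `b`, and
disjointness would identify that tuple with `a`. -/
lemma IsStronglyStable.corner_notMem_box (hI : IsStronglyStable I)
    (hE : IsIrredundantDecomposition I E) {a b : ExpTuple n} (ha : a ∈ E) (hb : b ∈ E) {k : ℕ}
    (hk : k < a.e) (hba : b.1 < a.1) : a.corner k ∉ b.box := fun h => by
  obtain ⟨c, hc, hcb, l, hl, hcone⟩ := ExpTuple.exists_mem_cone_corner (hI.exists_mem_box hE) hb h
  obtain ⟨rfl, -⟩ := ExpTuple.eq_of_mem_cone_corner hE.eq_of_box_subset_box ha hc hk hl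
    (a.mem_cone_corner k) hcone
  exact hcb.not_gt hba

/-- The image of the monomial `x^u` in the localization of `S/I` at `(x₁, …, x_{s+1})`. -/
noncomputable abbrev monomialImage (I : Ideal (MvPolynomial (Fin n) K)) (s : Fin n)
    (u : Fin n →₀ ℕ) : LocalizedModule (varIdeal K n (s.1 + 1)).primeCompl
      (MvPolynomial (Fin n) K ⧸ I) :=
  toLocalizedQuotient (varIdeal K n (s.1 + 1)) I (monomial u 1)

lemma monomialImage_eq_zero_or (hI : IsStronglyStable I) (hE : IsIrredundantDecomposition I E)
    {s : Fin n} {u : Fin n →₀ ℕ} (hu : ∀ a ∈ E, a.1 < s → u ∉ a.box) :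
    monomialImage I s u = 0 ∨ ∃ i ∈ cornerPairs E s, u ∈ cone s (i.1.corner i.2) ∧
      monomialImage I s u =
        (monomial (u - i.1.corner i.2) (1 : K)) • monomialImage I s (i.1.corner i.2) := by
  rw [or_iff_not_imp_left, hE.toLocalizedQuotient_eq_zero_iff]
  simp only [monomial_mem_irredIdeal_iff]
  intro h
  push Not at h
  obtain ⟨a, ha, has, hua⟩ := h
  obtain ⟨b, hb, hba, k, hk, hcone⟩ :=
    ExpTuple.exists_mem_cone_corner (hI.exists_mem_box hE) ha hua
  have hbs : b.1 = s := by
    have has : a.1 ≤ s := Nat.le_of_succ_le_succ has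
    refine le_antisymm (hba.trans has) (le_of_not_gt fun h => ?_)
    exact hu b hb h (b.cone_corner_subset_box hk hcone)
  refine ⟨⟨b, k⟩, mem_cornerPairs.2 ⟨hb, hbs, hk⟩, hbs ▸ hcone, ?_⟩
  rw [monomialImage, monomialImage, ← toLocalizedQuotient_mul, monomial_mul, mul_one,
    tsub_add_cancel_of_le (ExpTuple.corner_le_of_mem_cone hcone)]

lemma monomialImage_mem_span (hI : IsStronglyStable I) (hE : IsIrredundantDecomposition I E)
    {s : Fin n} {u : Fin n →₀ ℕ} (hu : ∀ a ∈ E, a.1 < s → u ∉ a.box) :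
    monomialImage I s u ∈ Submodule.span (Localization.AtPrime (varIdeal K n (s.1 + 1)))
      ((fun i : Σ _ : ExpTuple n, ℕ => monomialImage I s (i.1.corner i.2)) '' cornerPairs E s) := by
  rcases monomialImage_eq_zero_or hI hE hu with h | ⟨i, hi, -, h⟩
  · rw [h]; exact zero_mem _
  · rw [h]
    exact Submodule.smul_of_tower_mem _ _ (Submodule.subset_span ⟨i, hi, rfl⟩)

/-- If a power of `P_t` kills the image of `f`, so does a power of its last variable, which lies
outside the primes of the shorter components; hence every term of `f` lies in those, and
`monomialImage_mem_span` applies. Conversely, corners already lie in the shorter components, and a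
high power of `P_t` lies in all those of length `t`. -/
lemma zerothLocalCohomology_eq_span (hI : IsStronglyStable I)
    (hE : IsIrredundantDecomposition I E) (s : Fin n) :
    zerothLocalCohomology
        (IsLocalRing.maximalIdeal (Localization.AtPrime (varIdeal K n (s.1 + 1))))
        (LocalizedModule (varIdeal K n (s.1 + 1)).primeCompl (MvPolynomial (Fin n) K ⧸ I)) =
      Submodule.span (Localization.AtPrime (varIdeal K n (s.1 + 1)))
        ((fun i : Σ _ : ExpTuple n, ℕ => monomialImage I s (i.1.corner i.2)) '' cornerPairs E s) := by
  refine le_antisymm (fun y hy => ?_) (Submodule.span_le.2 ?_)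
  · obtain ⟨k, hk⟩ := mem_zerothLocalCohomology_iff.1 hy
    rw [forall_maximalIdeal_pow_smul_eq_zero_iff] at hk
    obtain ⟨r, hr, f, hf⟩ := exists_smul_eq_toLocalizedQuotient y
    refine mem_of_smul_mem_of_notMem _ hr ?_
    rw [hf, f.as_sum, map_sum]
    refine Submodule.sum_mem _ fun u hu => ?_
    have hmono : monomial u (coeff u f) =
        (C (coeff u f) : MvPolynomial (Fin n) K) * monomial u 1 := by
      rw [C_mul_monomial, mul_one]
    rw [hmono, toLocalizedQuotient_mul]
    refine Submodule.smul_of_tower_mem _ _ (monomialImage_mem_span hI hE fun b hb hbs => ?_)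
    have h0 : X s ^ k * f ∈ irredIdeal K b := by
      refine (hE.toLocalizedQuotient_eq_zero_iff (t := s.1 + 1)).1 ?_ b hb (Nat.succ_le_succ (le_of_lt hbs))
      rw [toLocalizedQuotient_mul, ← hf, smul_comm, hk, smul_zero]
      exact Ideal.pow_mem_pow (X_mem_varIdeal_iff.2 (Nat.lt_succ_self _)) k
    refine mem_irredIdeal_iff.1 (mem_irredIdeal_of_mul_mem (fun h => ?_) h0) u hu
    have := X_mem_varIdeal_iff.1 ((varIdeal_isPrime _).mem_of_pow_mem _ h)
    exact this.not_ge (Nat.succ_le_of_lt hbs)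
  · rintro _ ⟨i, hi, rfl⟩
    obtain ⟨hiE, rfl, hk⟩ := mem_cornerPairs.1 hi
    choose N hN using fun a : ExpTuple n => exists_varIdeal_pow_le (K := K) a
    refine mem_zerothLocalCohomology_iff.2 ⟨E.sup N, ?_⟩
    rw [forall_maximalIdeal_pow_smul_eq_zero_iff]
    intro r hr
    rw [← toLocalizedQuotient_mul, hE.toLocalizedQuotient_eq_zero_iff]
    intro b hb hbt
    rcases (Nat.le_of_succ_le_succ hbt : b.1 ≤ i.1.1).lt_or_eq with h | h
    · exact Ideal.mul_mem_left _ _ (monomial_mem_irredIdeal_iff.2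
        (hI.corner_notMem_box hE hiE hb hk h))
    · refine Ideal.mul_mem_right _ _ (hN b (Ideal.pow_le_pow_right (Finset.le_sup hb) ?_))
      rwa [ExpTuple.t, h]

lemma exists_mem_support_of_notMem_varIdeal {t : ℕ} {f : MvPolynomial (Fin n) K}
    (hf : f ∉ varIdeal K n t) : ∃ u ∈ f.support, ∀ j : Fin n, j.1 < t → u j = 0 := by
  rw [mem_varIdeal_iff] at hf
  push Not at hf
  exact hf

/-- The length multiplicity of `(x₁, …, x_t)` with respect to `S/I`. -/
theorem lengthMult_varIdeal (hI : IsStronglyStable I) (hE : IsIrredundantDecomposition I E)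
    (s : Fin n) :
    lengthMult (varIdeal K n (s.1 + 1)) (MvPolynomial (Fin n) K ⧸ I) =
      (∑ a ∈ E with a.1 = s, a.e : ℕ) := by
  classical
  rw [lengthMult, zerothLocalCohomology_eq_span hI hE, ← card_cornerPairs]
  -- Weight by degree: multiplying a corner by one of the first `t` variables yields zero or a
  -- corner of degree one higher.
  refine length_span_image_eq_card _ (fun i => (i.1.corner i.2).degree) _ ?_ ?_
  · intro i hi r hr
    obtain ⟨hiE, rfl, hk⟩ := mem_cornerPairs.1 hi
    refine smul_mem_of_mem_maximalIdeal (P := varIdeal K n (i.1.1.1 + 1))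
      (T := X '' {j : Fin n | j.1 < i.1.1.1 + 1}) rfl ?_ hr
    rintro _ ⟨j, hj, rfl⟩
    have hj : j ≤ i.1.1 := Nat.le_of_lt_succ hj
    have hX : (X j : MvPolynomial (Fin n) K) = monomial (Finsupp.single j 1) 1 := rfl
    rw [← toLocalizedQuotient_mul, hX, monomial_mul, mul_one]
    have hu : ∀ a ∈ E, a.1 < i.1.1 → Finsupp.single j 1 + i.1.corner i.2 ∉ a.box :=
      fun a ha hai h => hI.corner_notMem_box hE hiE ha hk hai
        (ExpTuple.mem_box_of_le le_add_self h)
    rcases monomialImage_eq_zero_or hI hE hu with h | ⟨i', hi', hcone, h⟩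
    · rw [monomialImage] at h; rw [h]; exact zero_mem _
    · rw [monomialImage] at h; rw [h]
      refine Submodule.smul_of_tower_mem _ _ (Submodule.subset_span ⟨i', ⟨hi', ?_⟩, rfl⟩)
      have heq : i'.1.corner i'.2 = Finsupp.single j 1 + i.1.corner i.2 := by
        ext l
        rcases le_or_gt l i.1.1 with hl | hl
        · exact (hcone l hl).symm
        · rw [i'.1.corner_of_gt _ ((mem_cornerPairs.1 hi').2.1 ▸ hl), Finsupp.add_apply,
            i.1.corner_of_gt _ hl, Finsupp.single_eq_of_ne (hj.trans_lt hl).ne']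
      rw [heq, map_add, Finsupp.degree_single]
      omega
  · intro i hi h
    obtain ⟨hiE, rfl, hk⟩ := mem_cornerPairs.1 hi
    rw [show (fun i' : Σ _ : ExpTuple n, ℕ => monomialImage I i.1.1 (i'.1.corner i'.2)) =
      toLocalizedQuotient _ I ∘ (fun u => monomial u 1) ∘ fun i' => i'.1.corner i'.2 from rfl,
      Set.image_comp, Set.image_comp] at h
    -- As `r ∉ P_t`, it has a term `x^m` in the later variables only. Then `m + corner` is an
    -- exponent outside `I`, so it occurs in `g` and dominates another corner; comparing degrees
    -- makes the two corners equal, against disjointness.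
    obtain ⟨r, hr, g, hg, hgI⟩ := exists_mul_sub_mem_of_mem_span h
    obtain ⟨m, hm, hm0⟩ := exists_mem_support_of_notMem_varIdeal hr
    have hcone : m + i.1.corner i.2 ∈ cone i.1.1 (i.1.corner i.2) := fun j hj => by
      rw [Finsupp.add_apply, hm0 j (Nat.lt_succ_of_le hj), zero_add]
    have hgm : m + i.1.corner i.2 ∈ g.support := by
      by_contra hgm
      refine hE.mem_iff.1 hgI (m + i.1.corner i.2) ?_ i.1 hiE (i.1.cone_corner_subset_box hk hcone)
      rw [mem_support_iff, coeff_sub, notMem_support_iff.1 hgm, sub_zero, coeff_mul_monomial,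
        mul_one]
      exact mem_support_iff.1 hm
    obtain ⟨_, ⟨i', ⟨hi', hne, hdeg⟩, rfl⟩, hle⟩ := mem_ideal_span_monomial_image.1 hg _ hgm
    obtain ⟨hiE', his', hk'⟩ := mem_cornerPairs.1 hi'
    have hle' : i'.1.corner i'.2 ≤ i.1.corner i.2 := fun j => by
      rcases le_or_gt j i.1.1 with hj | hj
      · exact (hle j).trans (hcone j hj).le
      · rw [i'.1.corner_of_gt _ (his' ▸ hj)]; exact Nat.zero_le _
    have heq : i'.1.corner i'.2 = i.1.corner i.2 := by
      have h1 := congrArg Finsupp.degree (tsub_add_cancel_of_le hle')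
      rw [map_add] at h1
      have h2 : (i.1.corner i.2 - i'.1.corner i'.2).degree = 0 := by omega
      rw [Finsupp.degree_eq_zero_iff, tsub_eq_zero_iff_le] at h2
      exact le_antisymm hle' h2
    obtain ⟨h1, h2⟩ := ExpTuple.eq_of_mem_cone_corner hE.eq_of_box_subset_box hiE' hiE hk' hk
      (i'.1.mem_cone_corner _) (by rw [heq]; exact i.1.mem_cone_corner _)
    exact hne (Sigma.ext h1 (heq_of_eq h2))

end Multiplicity

/-! ### Assembling the degree formulas -/

section Main

variable {K : Type*} [Field K] {n : ℕ} {I : Ideal (MvPolynomial (Fin n) K)}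
  {E : Finset (ExpTuple n)}

lemma degree_varIdeal (s : Fin n) : degree (varIdeal K n (s.1 + 1)) = 1 := by
  have hmem : ∀ f : MvPolynomial (Fin n) K, f ∈ varIdeal K n (s.1 + 1) ↔
      ∀ u ∈ f.support, u ∉ cone s 0 := fun f => by
    rw [mem_varIdeal_iff]
    refine forall₂_congr fun u _ => ?_
    rw [cone, Set.mem_ofPred_eq]
    push Not
    exact exists_congr fun j => and_congr_left' Nat.lt_succ_iff
  have := degree_eq_card_of_stanley hmem ({()} : Finset Unit) (fun _ => s) (fun _ => 0)
    (fun _ _ _ _ => rfl) (by simp) (by simp) (s₀ := s) (by simp) (by simp)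
  simpa using this

theorem degree_eq_sum (hI : IsStronglyStable I) (hE : IsIrredundantDecomposition I E) :
    degree I = ∑ a ∈ E with (a.t : ℕ∞) = I.height, (a.e : ℚ) := by
  classical
  rcases E.eq_empty_or_nonempty with rfl | hne
  · have hP : IsHilbertSamuelPoly I 0 := by
      refine Filter.Eventually.of_forall fun k => ?_
      rw [Finset.sum_eq_zero fun j _ => ?_]
      · simp
      · rw [hilbertFunction_eq_card (A := ∅) fun f => by simp [hE.mem_iff]]
        simp
    rw [degree_eq_of_isHilbertSamuelPoly hP]
    simp
  · obtain ⟨a₀, ha₀, hmin⟩ := E.exists_min_image (fun a => a.1) hne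
    have hheight := hE.height_eq ha₀ fun b hb => Nat.succ_le_succ (hmin b hb)
    have := degree_eq_card_of_stanley (I := I) (A := {u | ∃ a ∈ E, u ∈ a.box}) (s₀ := a₀.1)
      (fun f => by
        rw [hE.mem_iff]
        exact forall₂_congr fun u _ => by simp only [Set.mem_ofPred_eq, not_exists, not_and])
      (E.sigma fun a => Finset.range a.e) (fun i : Σ _ : ExpTuple n, ℕ => i.1.1)
      (fun i => i.1.corner i.2)
      (fun i _ j hj => i.1.corner_of_gt _ hj)
      (fun u => by
        constructor
        · rintro ⟨a, ha, hu⟩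
          obtain ⟨b, hb, -, k, hk, hcone⟩ :=
            ExpTuple.exists_mem_cone_corner (hI.exists_mem_box hE) ha hu
          exact ⟨⟨b, k⟩, by simp [hb, hk], hcone⟩
        · rintro ⟨i, hi, hu⟩
          simp only [Finset.mem_sigma, Finset.mem_range] at hi
          exact ⟨i.1, hi.1, i.1.cone_corner_subset_box hi.2 hu⟩)
      (fun u i hi j hj hui huj => by
        simp only [Finset.mem_sigma, Finset.mem_range] at hi hj
        obtain ⟨h1, h2⟩ := ExpTuple.eq_of_mem_cone_corner hE.eq_of_box_subset_box hi.1 hj.1 hi.2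
          hj.2 hui huj
        exact Sigma.ext h1 (heq_of_eq h2))
      ⟨⟨a₀, 0⟩, by simp [ha₀, a₀.e_pos], rfl⟩
      (fun i hi => hmin _ (Finset.mem_sigma.1 hi).1)
    rw [this, hheight, ← Nat.cast_sum]
    congr 1
    rw [show ((E.sigma fun a => Finset.range a.e).filter fun i => i.1.1 = a₀.1) =
      cornerPairs E a₀.1 by
        ext i; simp only [cornerPairs, Finset.mem_filter, Finset.mem_sigma]; tauto,
      card_cornerPairs]
    refine Finset.sum_congr (Finset.filter_congr fun a _ => ?_) fun _ _ => rfl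
    rw [Nat.cast_inj, ExpTuple.t, ExpTuple.t, Fin.ext_iff, Nat.add_right_cancel_iff]

lemma adegTerm_varIdeal (hI : IsStronglyStable I) (hE : IsIrredundantDecomposition I E)
    (s : Fin n) : adegTerm I ⟨varIdeal K n (s.1 + 1), inferInstance⟩ =
      ∑ a ∈ E with a.1 = s, (a.e : ℚ) := by
  rw [adegTerm, lengthMult_varIdeal hI hE, degree_varIdeal, ENat.toNat_natCast, mul_one, Nat.cast_sum]

/-- A sum of arithmetic degree terms over a set of associated primes. -/
lemma finsum_adegTerm (hI : IsStronglyStable I) (hE : IsIrredundantDecomposition I E)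
    {p : PrimeSpectrum (MvPolynomial (Fin n) K) → Prop} {q : Fin n → Prop} [DecidablePred q]
    (hp : ∀ P, p P → ∃ a ∈ E, P.asIdeal = varIdeal K n a.t)
    (hq : ∀ a ∈ E, p ⟨varIdeal K n a.t, inferInstance⟩ ↔ q a.1) :
    ∑ᶠ (P) (_ : p P), adegTerm I P = ∑ a ∈ E with q a.1, (a.e : ℚ) := by
  classical
  let F : Fin n → PrimeSpectrum (MvPolynomial (Fin n) K) := fun s =>
    ⟨varIdeal K n (s.1 + 1), inferInstance⟩
  have hF : Function.Injective F := fun s t h =>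
    Fin.ext (Nat.succ_injective (varIdeal_injOn s.2 t.2 (congrArg PrimeSpectrum.asIdeal h)))
  have hmem : ∀ P, p P ↔ P ∈ (((E.filter fun a => q a.1).image fun a => a.1).image F) := by
    intro P
    simp only [Finset.mem_image, Finset.mem_filter]
    constructor
    · intro h
      obtain ⟨a, ha, hPa⟩ := hp P h
      have : P = F a.1 := PrimeSpectrum.ext hPa
      exact ⟨a.1, ⟨a, ⟨ha, (hq a ha).1 (show p (F a.1) from this ▸ h)⟩, rfl⟩, this.symm⟩
    · rintro ⟨_, ⟨a, ⟨ha, hqa⟩, rfl⟩, rfl⟩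
      exact (hq a ha).2 hqa
  simp only [hmem]
  rw [finsum_mem_finset_eq_sum, Finset.sum_image hF.injOn]
  -- Distinct lengths give distinct primes, so grouping the tuples by length matches the sum over
  -- primes.
  rw [← Finset.sum_fiberwise_of_maps_to (g := fun a : ExpTuple n => a.1)
    (fun a ha => Finset.mem_image_of_mem _ ha)]
  refine Finset.sum_congr rfl fun s hs => ?_
  rw [adegTerm_varIdeal hI hE, Finset.filter_filter]
  refine Finset.sum_congr (Finset.filter_congr fun a _ => ?_) fun _ _ => rfl
  obtain ⟨b, hb, rfl⟩ := Finset.mem_image.1 hs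
  exact ⟨fun h => ⟨h ▸ (Finset.mem_filter.1 hb).2, h⟩, fun h => h.2⟩

end Main

end StronglyStable

theorem mainTheorem5 {K : Type*} [Field K] {n : ℕ} (I : Ideal (MvPolynomial (Fin n) K))
    (hI : StronglyStable.IsStronglyStable I) (E : Finset (StronglyStable.ExpTuple n))
    (hE : StronglyStable.IsIrredundantDecomposition I E) :
    (∀ i : ℕ, StronglyStable.adegAt I i = ∑ a ∈ E with a.t + i = n, (a.e : ℚ)) ∧
    StronglyStable.adeg I = ∑ a ∈ E, (a.e : ℚ) ∧
    StronglyStable.degree I = ∑ a ∈ E with (a.t : ℕ∞) = I.height, (a.e : ℚ) := by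
  refine ⟨fun i => ?_, ?_, StronglyStable.degree_eq_sum hI hE⟩
  · refine StronglyStable.finsum_adegTerm hI hE (q := fun s => s.1 + 1 + i = n)
      (fun P hP => hE.isAssociatedPrime_iff.1 hP.1) fun a ha => ?_
    -- The dimension condition is `n - t(a) = i`; as `t(a) ≤ n`, the truncated subtraction agrees
    -- with `t(a) + i = n`.
    rw [and_iff_right (hE.isAssociatedPrime_iff.2 ⟨a, ha, rfl⟩),
      StronglyStable.ringKrullDim_quotient_varIdeal a.t_le]
    have h := a.t_le
    unfold StronglyStable.ExpTuple.t at *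
    rw [Nat.cast_inj]
    omega
  · have := StronglyStable.finsum_adegTerm hI hE (q := fun _ => True)
      (fun P hP => hE.isAssociatedPrime_iff.1 hP)
      fun a ha => iff_true_intro (hE.isAssociatedPrime_iff.2 ⟨a, ha, rfl⟩)
    rw [Finset.filter_true] at this
    exact this
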